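/- Consider the hexagonal grid, formed by a tessellation of the plane $\mathbb{R}^2$ into regular hexagons of side length 1. Let $Z$ be a cycle of the hexagonal grid, viewed as a closed curve in the plane. The closed region bounded by $Z$ consists of the points of $Z$ and of the points of the bounded components of $\mathbb{R}^2\setminus Z$. The benzenoid system bounded by $Z$ is the subgraph $G=(V,E)$ of the hexagonal grid formed by all vertices and all edges of the grid that lie in this closed region. For a connected graph $G=(V,E)$ with shortest-path distance $d$ and an integer $p\ge 1$, the power $G^p$ is the graph on $V$ in which two distinct vertices $u,v$ are adjacent if and only if $d(u,v)\le p$. A profile is a map $\pi:V\to[0,\infty)$ with finite support, its median function is $F_\pi(v)=\sum_{u\in V}\pi(u)\,d(u,v)$, and its median set $\mathrm{Med}(\pi)$ is the set of all vertices of $G$ minimizing $F_\pi$ over $V$. The graph $G$ has $G^p$-connected medians if for every profile $\pi$ the set $\mathrm{Med}(\pi)$ induces a connected nonempty subgraph of $G^p$. Proposition. Every benzenoid system $G$ is connected and has $G^2$-connected medians. -/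

import Mathlib

open scoped NNReal

namespace Benzenoid

/-! ### Median sets and powers of graphs -/

/-- The `p`-th power of `G`: distinct vertices at distance at most `p` in `G` are adjacent. -/
def graphPower {V : Type*} (G : SimpleGraph V) (p : ℕ) : SimpleGraph V where
  Adj u v := u ≠ v ∧ G.edist u v ≤ (p : ℕ∞)
  symm := ⟨fun u v h => ⟨h.1.symm, by rw [SimpleGraph.edist_comm]; exact h.2⟩⟩
  loopless := ⟨fun _ h => h.1 rfl⟩

/-- The median function `F_π(v) = ∑ π(u) d(u, v)` of a finitely supported nonnegative
weight function (profile) `π`. -/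
noncomputable def medianFun {V : Type*} (G : SimpleGraph V) (π : V →₀ ℝ≥0) (v : V) : ℝ :=
  π.sum fun u w => (w : ℝ) * (G.dist u v : ℝ)

/-- The median set: all global minimizers of the median function. -/
def medianSet {V : Type*} (G : SimpleGraph V) (π : V →₀ ℝ≥0) : Set V :=
  {v | ∀ w, medianFun G π v ≤ medianFun G π w}

/-- `G` has `G^p`-connected medians: every median set induces a connected (in particular
nonempty) subgraph of `G^p`.  As graph distances between the vertices are used, this is only
meant for connected graphs, and connectedness is made part of the definition. -/
def HasPowerConnectedMedians {V : Type*} (G : SimpleGraph V) (p : ℕ) : Prop :=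
  G.Connected ∧ ∀ π : V →₀ ℝ≥0, ((graphPower G p).induce (medianSet G π)).Connected

/-! ### The hexagonal grid -/

/-- Vertices of the hexagonal grid: integer triples with coordinate sum `0` or `1`. The triple
`(x, y, z)` stands for the point `x + y ω + z ω²` of the plane, where `ω = exp(2πi/3)`. -/
@[ext]
structure HexVertex where
  x : ℤ
  y : ℤ
  z : ℤ
  sum_eq : x + y + z = 0 ∨ x + y + z = 1

/-- The position `x + y ω + z ω²` of a vertex in the plane, where `ω = -1/2 + (√3/2) i`. -/
noncomputable def HexVertex.pos (v : HexVertex) : ℂ :=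
  ⟨(v.x : ℝ) - ((v.y : ℝ) + (v.z : ℝ)) / 2, Real.sqrt 3 / 2 * ((v.y : ℝ) - (v.z : ℝ))⟩

/-- The hexagonal grid, the 1-skeleton of the tessellation of the plane by regular hexagons of
side length 1: two vertices are adjacent iff their triples differ by one in exactly one coordinate
(equivalently, iff their positions are at Euclidean distance 1, see `hexGrid_adj_iff_dist`). -/
def hexGrid : SimpleGraph HexVertex where
  Adj u v := |u.x - v.x| + |u.y - v.y| + |u.z - v.z| = 1
  symm := ⟨fun u v h => by
    rw [abs_sub_comm v.x, abs_sub_comm v.y, abs_sub_comm v.z]; exact h⟩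
  loopless := ⟨fun u h => by simp at h⟩

/-! ### Benzenoid systems -/

/-- The closed curve in the plane traced by a closed walk of the hexagonal grid: the union of the
straight segments realizing its edges. -/
def curve {v : HexVertex} (Z : hexGrid.Walk v v) : Set ℂ :=
  {p | ∃ a b : HexVertex, s(a, b) ∈ Z.edges ∧ p ∈ segment ℝ a.pos b.pos}

/-- The closed region of the plane bounded by `Z`: the points of the curve together with the points
of the bounded components of its complement. -/
def closedRegion {v : HexVertex} (Z : hexGrid.Walk v v) : Set ℂ :=
  {p | p ∈ curve Z ∨
    (p ∉ curve Z ∧ Bornology.IsBounded (connectedComponentIn (curve Z)ᶜ p))}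

/-- The subgraph of the hexagonal grid formed by all vertices and all edges lying in the closed
region bounded by `Z`. When `Z` is a cycle, it is the benzenoid system bounded by `Z`. -/
def benzenoidSystem {v : HexVertex} (Z : hexGrid.Walk v v) : hexGrid.Subgraph where
  verts := {a | a.pos ∈ closedRegion Z}
  Adj a b := hexGrid.Adj a b ∧ segment ℝ a.pos b.pos ⊆ closedRegion Z
  adj_sub h := h.1
  edge_vert h := h.2 (left_mem_segment ℝ _ _)
  symm := ⟨fun a b h => ⟨h.1.symm, by rw [segment_symm]; exact h.2⟩⟩

theorem hexGrid_adj_iff_dist (u v : HexVertex) :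
    hexGrid.Adj u v ↔ dist u.pos v.pos = 1 := by
  obtain ⟨a, b, c, h⟩ := u
  obtain ⟨a', b', c', h'⟩ := v
  have key : dist (HexVertex.pos ⟨a, b, c, h⟩) (HexVertex.pos ⟨a', b', c', h'⟩) ^ 2 =
      (((a - a') ^ 2 + (b - b') ^ 2 + (c - c') ^ 2 - (a - a') * (b - b') - (b - b') * (c - c')
        - (c - c') * (a - a') : ℤ) : ℝ) := by
    have h3 : Real.sqrt 3 ^ 2 = 3 := Real.sq_sqrt (by norm_num)
    rw [Complex.dist_eq, ← Complex.normSq_eq_norm_sq, Complex.normSq_apply]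
    simp only [HexVertex.pos, Complex.sub_re, Complex.sub_im]
    push_cast
    linear_combination ((b - b' - (c - c') : ℝ) ^ 2 / 4) * h3
  have h1 : dist (HexVertex.pos ⟨a, b, c, h⟩) (HexVertex.pos ⟨a', b', c', h'⟩) = 1 ↔
      (a - a') ^ 2 + (b - b') ^ 2 + (c - c') ^ 2 - (a - a') * (b - b') - (b - b') * (c - c')
        - (c - c') * (a - a') = 1 := by
    rw [← pow_eq_one_iff_of_nonneg dist_nonneg two_ne_zero, key]
    norm_cast
  rw [h1]
  change |a - a'| + |b - b'| + |c - c'| = 1 ↔ _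
  have hs : (a - a') + (b - b') + (c - c') = -1 ∨ (a - a') + (b - b') + (c - c') = 0 ∨
      (a - a') + (b - b') + (c - c') = 1 := by omega
  generalize a - a' = x at *
  generalize b - b' = y at *
  generalize c - c' = z at *
  constructor
  · intro hh
    simp only [Int.abs_eq_natAbs] at hh
    have : (x = 0 ∧ y = 0 ∧ (z = 1 ∨ z = -1)) ∨ (x = 0 ∧ z = 0 ∧ (y = 1 ∨ y = -1)) ∨
        (z = 0 ∧ y = 0 ∧ (x = 1 ∨ x = -1)) := by omega
    rcases this with ⟨rfl, rfl, rfl | rfl⟩ | ⟨rfl, rfl, rfl | rfl⟩ | ⟨rfl, rfl, rfl | rfl⟩ <;>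
      norm_num
  · intro hh
    have hq : 3 * (x ^ 2 + y ^ 2 + z ^ 2) = 2 + (x + y + z) ^ 2 := by linear_combination 2 * hh
    have hsq : x ^ 2 + y ^ 2 + z ^ 2 = 1 := by
      rcases hs with hs | hs | hs <;> rw [hs] at hq <;> omega
    have hx : x ^ 2 ≤ 1 := by nlinarith [sq_nonneg y, sq_nonneg z]
    have hy : y ^ 2 ≤ 1 := by nlinarith [sq_nonneg x, sq_nonneg z]
    have hz : z ^ 2 ≤ 1 := by nlinarith [sq_nonneg y, sq_nonneg x]
    obtain ⟨hx1, hx2⟩ := abs_le.mp ((sq_le_one_iff_abs_le_one x).mp hx)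
    obtain ⟨hy1, hy2⟩ := abs_le.mp ((sq_le_one_iff_abs_le_one y).mp hy)
    obtain ⟨hz1, hz2⟩ := abs_le.mp ((sq_le_one_iff_abs_le_one z).mp hz)
    interval_cases x <;> interval_cases y <;> interval_cases z <;> simp_all

end Benzenoid

namespace Benzenoid

/-! ### Connectedness of median sets -/

section Medians

variable {V : Type*} {G : SimpleGraph V}

theorem medianFun_add_le (π : V →₀ ℝ≥0) {u v p q : V}
    (h : ∀ s, G.dist s p + G.dist s q ≤ G.dist s u + G.dist s v) :
    medianFun G π p + medianFun G π q ≤ medianFun G π u + medianFun G π v := by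
  simp only [medianFun, Finsupp.sum]
  rw [← Finset.sum_add_distrib, ← Finset.sum_add_distrib]
  refine Finset.sum_le_sum fun s _ => ?_
  rw [← mul_add, ← mul_add]
  exact mul_le_mul_of_nonneg_left (by exact_mod_cast h s) (π s).coe_nonneg

/-- If any two vertices at distance greater than `p` can be replaced by a pair of vertices, the
first of which is closer to both, without increasing any sum of distances, then median sets are
connected in the `p`-th power. -/
theorem hasPowerConnectedMedians_of_exists_closer [Finite V] (hG : G.Connected) (p : ℕ)
    (h : ∀ u v, p < G.dist u v → ∃ a b, G.dist a u < G.dist u v ∧ G.dist a v < G.dist u v ∧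
      ∀ s, G.dist s a + G.dist s b ≤ G.dist s u + G.dist s v) :
    HasPowerConnectedMedians G p := by
  refine ⟨hG, fun π => ?_⟩
  have hne : (medianSet G π).Nonempty := by
    have := hG.nonempty
    obtain ⟨m, hm⟩ := Finite.exists_min (medianFun G π)
    exact ⟨m, hm⟩
  have : Nonempty (medianSet G π) := hne.to_subtype
  refine SimpleGraph.Connected.mk ?_
  have key : ∀ n, ∀ u v : medianSet G π, G.dist u.1 v.1 = n →
      ((graphPower G p).induce (medianSet G π)).Reachable u v := by
    intro n
    induction n using Nat.strong_induction_on with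
    | _ n ih =>
      rintro u v hn
      by_cases hp : n ≤ p
      · by_cases huv : u = v
        · rw [huv]
        · refine SimpleGraph.Adj.reachable ⟨fun e => huv (Subtype.ext e), ?_⟩
          change G.edist u.1 v.1 ≤ p
          rw [← (hG u.1 v.1).coe_dist_eq_edist]
          exact_mod_cast hn.trans_le hp
      · obtain ⟨a, b, hau, hav, hab⟩ := h u.1 v.1 (by omega)
        have hsum := medianFun_add_le π hab
        have ha : a ∈ medianSet G π := fun w => by
          -- `F(a) ≤ F(u) + F(v) - F(b)`, where `F(u) ≤ F(b)` and `F(v) ≤ F(w)`.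
          have h1 := u.2 b
          have h2 := v.2 w
          linarith
        have r1 := ih _ (hn ▸ hau) ⟨a, ha⟩ u rfl
        have r2 := ih _ (hn ▸ hav) ⟨a, ha⟩ v rfl
        exact r1.symm.trans r2
  exact fun u v => key _ u v rfl

/-- A relation chain along which a property changes has a step where it changes. -/
theorem exists_step_of_reflTransGen {α : Type*} {r : α → α → Prop} {P : α → Prop} {a b : α}
    (h : Relation.ReflTransGen r a b) (ha : P a) (hb : ¬ P b) :
    ∃ s t, r s t ∧ P s ∧ ¬ P t := by
  induction h with
  | refl => exact absurd ha hb
  | @tail s t _ hst ih =>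
    by_cases hs : P s
    · exact ⟨s, t, hst, hs, hb⟩
    · exact ih hs

theorem exists_adj_of_geodesic (hG : G.Connected) {P : V → Prop} {a b : V} (ha : P a)
    (hb : ¬ P b) : ∃ s t, G.Adj s t ∧ P s ∧ ¬ P t ∧
      G.dist a b = G.dist a s + 1 + G.dist t b := by
  obtain ⟨w, hw⟩ := hG.exists_walk_length_eq_dist a b
  have key : ∀ {a b : V} (w : G.Walk a b), P a → ¬ P b → ∃ s t, G.Adj s t ∧ P s ∧ ¬ P t ∧
      G.dist a s + 1 + G.dist t b ≤ w.length := by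
    intro a b w ha hb
    induction w with
    | nil => exact absurd ha hb
    | @cons x y z hxy w ih =>
      by_cases hy : P y
      · obtain ⟨s, t, hst, hs, ht, hle⟩ := ih hy hb
        refine ⟨s, t, hst, hs, ht, ?_⟩
        have h1 := hG.dist_triangle (u := x) (v := y) (w := s)
        have h2 := SimpleGraph.dist_eq_one_iff_adj.2 hxy
        rw [SimpleGraph.Walk.length_cons]
        omega
      · refine ⟨x, y, hxy, ha, hy, ?_⟩
        have h2 := SimpleGraph.dist_le w
        rw [SimpleGraph.Walk.length_cons, SimpleGraph.dist_self]
        omega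
  obtain ⟨s, t, hst, hs, ht, hle⟩ := key w ha hb
  refine ⟨s, t, hst, hs, ht, ?_⟩
  have h1 := hG.dist_triangle (u := a) (v := s) (w := b)
  have h2 := hG.dist_triangle (u := s) (v := t) (w := b)
  have h3 := SimpleGraph.dist_eq_one_iff_adj.2 hst
  omega

/-- If a predicate changes only along edges that are translates of the edge `uw`,
then it cuts out the halfspaces of `uw`. -/
theorem dist_lt_dist_of_cut (hG : G.Connected) {f : V → Prop} {u w : V}
    (huw : ¬ (f u ↔ f w))
    (hcut : ∀ p q, G.Adj p q → ¬ (f p ↔ f q) → G.dist p u = G.dist q w) {s : V} :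
    (f s ↔ f u) → G.dist s u < G.dist s w := by
  intro hs
  -- A geodesic from `s` to `w` leaves the side of `u` along some `pq`; as `d(q,w) = d(p,u)`, going
  -- on from `p` to `u` instead saves the step `pq`.
  obtain ⟨p, q, hpq, hp, hq, hd⟩ := exists_adj_of_geodesic hG (P := fun x => f x ↔ f u)
    (a := s) (b := w) hs (fun e => huw e.symm)
  have h1 := hcut p q hpq (fun e => hq (e.symm.trans hp))
  have h2 := hG.dist_triangle (u := s) (v := p) (w := u)
  omega

end Medians

/-! ### Cells of the hexagonal grid and charts of graphs -/

theorem hexGrid_adj_iff (P Q : HexVertex) : hexGrid.Adj P Q ↔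
    (Q.x = P.x + 1 ∧ Q.y = P.y ∧ Q.z = P.z) ∨ (Q.x = P.x - 1 ∧ Q.y = P.y ∧ Q.z = P.z) ∨
    (Q.x = P.x ∧ Q.y = P.y + 1 ∧ Q.z = P.z) ∨ (Q.x = P.x ∧ Q.y = P.y - 1 ∧ Q.z = P.z) ∨
    (Q.x = P.x ∧ Q.y = P.y ∧ Q.z = P.z + 1) ∨ (Q.x = P.x ∧ Q.y = P.y ∧ Q.z = P.z - 1) := by
  change |P.x - Q.x| + |P.y - Q.y| + |P.z - Q.z| = 1 ↔ _
  simp only [Int.abs_eq_natAbs]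
  omega

/-- The hexagons of the grid: `⟨a, b, c⟩` is the hexagon with vertices in
`{a, a + 1} × {b, b + 1} × {c, c + 1}`. -/
@[ext]
structure HexCell where
  a : ℤ
  b : ℤ
  c : ℤ
  sum_eq : a + b + c = -1

/-- `v` is a vertex of the hexagon `h`. -/
def Incident (v : HexVertex) (h : HexCell) : Prop :=
  (h.a ≤ v.x ∧ v.x ≤ h.a + 1) ∧ (h.b ≤ v.y ∧ v.y ≤ h.b + 1) ∧ (h.c ≤ v.z ∧ v.z ≤ h.c + 1)

/-- A symmetry of the hexagonal grid. -/
structure GridAut where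
  vert : HexVertex ≃ HexVertex
  cell : HexCell ≃ HexCell
  adj_iff : ∀ P Q, hexGrid.Adj (vert P) (vert Q) ↔ hexGrid.Adj P Q
  incident_iff : ∀ P h, Incident (vert P) (cell h) ↔ Incident P h

/-- The cyclic rotation of the coordinates. -/
def GridAut.rot : GridAut where
  vert :=
    { toFun := fun P => ⟨P.y, P.z, P.x, by have := P.sum_eq; omega⟩
      invFun := fun P => ⟨P.z, P.x, P.y, by have := P.sum_eq; omega⟩
      left_inv := fun _ => rfl
      right_inv := fun _ => rfl }
  cell :=
    { toFun := fun h => ⟨h.b, h.c, h.a, by have := h.sum_eq; omega⟩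
      invFun := fun h => ⟨h.c, h.a, h.b, by have := h.sum_eq; omega⟩
      left_inv := fun _ => rfl
      right_inv := fun _ => rfl }
  adj_iff P Q := by
    change |P.y - Q.y| + |P.z - Q.z| + |P.x - Q.x| = 1 ↔
      |P.x - Q.x| + |P.y - Q.y| + |P.z - Q.z| = 1
    rw [add_comm, add_assoc]
  incident_iff P h := by simp only [Incident, Equiv.coe_fn_mk]; omega

/-- The exchange of the last two coordinates. -/
def GridAut.swap : GridAut where
  vert :=
    { toFun := fun P => ⟨P.x, P.z, P.y, by have := P.sum_eq; omega⟩
      invFun := fun P => ⟨P.x, P.z, P.y, by have := P.sum_eq; omega⟩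
      left_inv := fun _ => rfl
      right_inv := fun _ => rfl }
  cell :=
    { toFun := fun h => ⟨h.a, h.c, h.b, by have := h.sum_eq; omega⟩
      invFun := fun h => ⟨h.a, h.c, h.b, by have := h.sum_eq; omega⟩
      left_inv := fun _ => rfl
      right_inv := fun _ => rfl }
  adj_iff P Q := by
    change |P.x - Q.x| + |P.z - Q.z| + |P.y - Q.y| = 1 ↔
      |P.x - Q.x| + |P.y - Q.y| + |P.z - Q.z| = 1
    rw [add_right_comm]
  incident_iff P h := by simp only [Incident, Equiv.coe_fn_mk]; omega

/-- A point reflection, exchanging the two classes of vertices. -/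
def GridAut.inv : GridAut where
  vert :=
    { toFun := fun P => ⟨-P.x, -P.y, 1 - P.z, by have := P.sum_eq; omega⟩
      invFun := fun P => ⟨-P.x, -P.y, 1 - P.z, by have := P.sum_eq; omega⟩
      left_inv := fun P => by ext <;> simp
      right_inv := fun P => by ext <;> simp }
  cell :=
    { toFun := fun h => ⟨-1 - h.a, -1 - h.b, -h.c, by have := h.sum_eq; omega⟩
      invFun := fun h => ⟨-1 - h.a, -1 - h.b, -h.c, by have := h.sum_eq; omega⟩
      left_inv := fun P => by ext <;> simp
      right_inv := fun P => by ext <;> simp }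
  adj_iff P Q := by
    change |-P.x - -Q.x| + |-P.y - -Q.y| + |1 - P.z - (1 - Q.z)| = 1 ↔
      |P.x - Q.x| + |P.y - Q.y| + |P.z - Q.z| = 1
    rw [neg_sub_neg, neg_sub_neg, sub_sub_sub_cancel_left, abs_sub_comm Q.x, abs_sub_comm Q.y,
      abs_sub_comm Q.z]
  incident_iff P h := by simp only [Incident, Equiv.coe_fn_mk]; omega

variable {V : Type*} {G : SimpleGraph V}

/-- The edge `PQ` of the grid is the image of an edge of `G` under `f`. -/
def IsEdgeImage (G : SimpleGraph V) (f : V → HexVertex) (P Q : HexVertex) : Prop :=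
  ∃ p q, f p = P ∧ f q = Q ∧ G.Adj p q

/-- All edges of the hexagon `h` are images of edges of `G`. -/
def IsFull (G : SimpleGraph V) (f : V → HexVertex) (h : HexCell) : Prop :=
  ∀ P Q, Incident P h → Incident Q h → hexGrid.Adj P Q → IsEdgeImage G f P Q

/-- The hexagons `h` and `h'` have a common edge which does not belong to the image of `G`. -/
def IsLink (G : SimpleGraph V) (f : V → HexVertex) (h h' : HexCell) : Prop :=
  ∃ P Q, hexGrid.Adj P Q ∧ Incident P h ∧ Incident Q h ∧ Incident P h' ∧ Incident Q h' ∧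
    ¬ IsEdgeImage G f P Q

/-- An embedding of `G` in the hexagonal grid as a bounded subgraph without holes. -/
structure Chart (G : SimpleGraph V) where
  toFun : V → HexVertex
  inj : Function.Injective toFun
  adj : ∀ p q, G.Adj p q → hexGrid.Adj (toFun p) (toFun q)
  finite_full : {h | IsFull G toFun h}.Finite
  linked : ∀ h h', ¬ IsFull G toFun h → ¬ IsFull G toFun h' →
    Relation.ReflTransGen (IsLink G toFun) h h'

/-! ### Transport of charts by grid symmetries -/

theorem isEdgeImage_aut (σ : GridAut) (f : V → HexVertex) (P Q : HexVertex) :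
    IsEdgeImage G (σ.vert ∘ f) (σ.vert P) (σ.vert Q) ↔ IsEdgeImage G f P Q := by
  simp [IsEdgeImage]

theorem isFull_aut (σ : GridAut) (f : V → HexVertex) (h : HexCell) :
    IsFull G (σ.vert ∘ f) (σ.cell h) ↔ IsFull G f h := by
  unfold IsFull
  rw [σ.vert.surjective.forall₂]
  simp only [σ.incident_iff, σ.adj_iff, isEdgeImage_aut]

theorem isLink_aut (σ : GridAut) (f : V → HexVertex) (h h' : HexCell) :
    IsLink G (σ.vert ∘ f) (σ.cell h) (σ.cell h') ↔ IsLink G f h h' := by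
  unfold IsLink
  rw [σ.vert.surjective.exists₂]
  simp only [σ.incident_iff, σ.adj_iff, isEdgeImage_aut]

/-- Composition of a chart with a symmetry of the grid. -/
def Chart.comp (χ : Chart G) (σ : GridAut) : Chart G where
  toFun := σ.vert ∘ χ.toFun
  inj := σ.vert.injective.comp χ.inj
  adj p q h := (σ.adj_iff _ _).2 (χ.adj p q h)
  finite_full := by
    refine (χ.finite_full.image σ.cell).subset fun h hh => ?_
    obtain ⟨h, rfl⟩ := σ.cell.surjective h
    exact ⟨h, (isFull_aut σ _ h).1 hh, rfl⟩
  linked h h' hh hh' := by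
    obtain ⟨h, rfl⟩ := σ.cell.surjective h
    obtain ⟨h', rfl⟩ := σ.cell.surjective h'
    rw [isFull_aut] at hh hh'
    exact (χ.linked h h' hh hh').lift σ.cell fun a b hab => (isLink_aut σ _ a b).2 hab

/-- The edge `PQ` crosses the ray that starts at the center of `h` and runs along the line
`x = h.a + 1/2` in the direction of increasing `y`. -/
def CrossesRay (h : HexCell) (P Q : HexVertex) : Prop :=
  P.x + Q.x = 2 * h.a + 1 ∧ h.b < P.y

/-- An edge of the grid is determined by its midpoint. -/
theorem eq_or_eq_of_midpoint {P Q P' Q' : HexVertex} (h : hexGrid.Adj P Q)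
    (h' : hexGrid.Adj P' Q') (hx : P.x + Q.x = P'.x + Q'.x) (hy : P.y + Q.y = P'.y + Q'.y)
    (hz : P.z + Q.z = P'.z + Q'.z) : (P = P' ∧ Q = Q') ∨ (P = Q' ∧ Q = P') := by
  simp only [HexVertex.ext_iff]
  rw [hexGrid_adj_iff] at h h'
  rcases h with h | h | h | h | h | h <;> rcases h' with h' | h' | h' | h' | h' | h' <;>
    first | (left; omega) | (right; omega)

set_option maxHeartbeats 800000 in
-- The edges crossed by exactly one of the two rays form, up to the edge shared by `h` and `h'`, the
-- boundary of a set `φ` of vertices lying between the rays. The shared edge is not in `G`, so on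
-- `G` the symmetric difference is a cut. The cases of `hc` are half of the possible relative
-- positions; exchanging `h` and `h'` gives the others.
theorem exists_potential_of_isLink_aux {f : V → HexVertex} {h h' : HexCell}
    (hl : IsLink G f h h') (hc : (h'.a = h.a ∧ h'.b = h.b) ∨
      (h'.a = h.a ∧ h'.b = h.b + 1) ∨ (h'.a = h.a + 1 ∧ h'.b = h.b) ∨
      (h'.a = h.a + 1 ∧ h'.b = h.b - 1)) :
    ∃ φ : HexVertex → Prop, ∀ P Q, hexGrid.Adj P Q → IsEdgeImage G f P Q →
      ((φ P ↔ φ Q) ↔ (CrossesRay h P Q ↔ CrossesRay h' P Q)) := by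
  obtain ⟨P₀, Q₀, hadj, hP, hQ, hP', hQ', hE⟩ := hl
  have hne : ∀ P Q, hexGrid.Adj P Q → IsEdgeImage G f P Q →
      ¬ (P.x + Q.x = P₀.x + Q₀.x ∧ P.y + Q.y = P₀.y + Q₀.y ∧ P.z + Q.z = P₀.z + Q₀.z) := by
    rintro P Q hPQ ⟨p, q, hp, hq, hpq⟩ ⟨hx, hy, hz⟩
    rcases eq_or_eq_of_midpoint hPQ hadj hx hy hz with ⟨rfl, rfl⟩ | ⟨rfl, rfl⟩
    · exact hE ⟨p, q, hp, hq, hpq⟩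
    · exact hE ⟨q, p, hq, hp, hpq.symm⟩
  have s1 := h.sum_eq
  have s2 := h'.sum_eq
  have s3 := P₀.sum_eq
  have s4 := Q₀.sum_eq
  rw [hexGrid_adj_iff] at hadj
  simp only [Incident] at hP hQ hP' hQ'
  rcases hc with hc | hc | hc | hc
  · refine ⟨fun _ => True, fun P Q hPQ hE' => ?_⟩
    simp only [CrossesRay, hc]
  · refine ⟨fun P => True, fun P Q hPQ hE' => ?_⟩
    have hn := hne P Q hPQ hE'
    have s5 := P.sum_eq
    have s6 := Q.sum_eq
    have hx : P₀.x + Q₀.x = 2 * h.a + 1 ∧ P₀.y = h.b + 1 ∧ Q₀.y = h.b + 1 ∧ P₀.z = h.c ∧ Q₀.z = h.c := by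
      rcases hadj with h1 | h1 | h1 | h1 | h1 | h1 <;> omega
    clear hP hQ hP' hQ' hadj s3 s4
    rw [hexGrid_adj_iff] at hPQ
    simp only [CrossesRay, true_iff, hc.1, hc.2]
    rcases hPQ with h1 | h1 | h1 | h1 | h1 | h1 <;> omega
  -- The rays lie in neighbouring columns; `φ` is the part of the zigzag `x = h.a + 1` between them,
  -- and it ends at the shared edge.
  · refine ⟨fun P => P.x = h.a + 1 ∧ h.b + 1 ≤ P.y, fun P Q hPQ hE' => ?_⟩
    have hn := hne P Q hPQ hE'
    have s5 := P.sum_eq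
    have s6 := Q.sum_eq
    have hx : P₀.y + Q₀.y = 2 * h.b + 1 ∧ P₀.x = h.a + 1 ∧ Q₀.x = h.a + 1 ∧
        P₀.z = h.c ∧ Q₀.z = h.c := by
      rcases hadj with h1 | h1 | h1 | h1 | h1 | h1 <;> omega
    clear hP hQ hP' hQ' hadj s3 s4
    rw [hexGrid_adj_iff] at hPQ
    simp only [CrossesRay]
    rcases hPQ with h1 | h1 | h1 | h1 | h1 | h1 <;> omega
  · refine ⟨fun P => P.x = h.a + 1 ∧ P.z ≤ h.c, fun P Q hPQ hE' => ?_⟩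
    have hn := hne P Q hPQ hE'
    have s5 := P.sum_eq
    have s6 := Q.sum_eq
    have hx : P₀.z + Q₀.z = 2 * h.c + 1 ∧ P₀.x = h.a + 1 ∧ Q₀.x = h.a + 1 ∧
        P₀.y = h.b ∧ Q₀.y = h.b := by
      rcases hadj with h1 | h1 | h1 | h1 | h1 | h1 <;> omega
    clear hP hQ hP' hQ' hadj s3 s4
    rw [hexGrid_adj_iff] at hPQ
    simp only [CrossesRay]
    rcases hPQ with h1 | h1 | h1 | h1 | h1 | h1 <;> omega

theorem exists_potential_of_isLink {f : V → HexVertex} {h h' : HexCell} (hl : IsLink G f h h') :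
    ∃ φ : HexVertex → Prop, ∀ P Q, hexGrid.Adj P Q → IsEdgeImage G f P Q →
      ((φ P ↔ φ Q) ↔ (CrossesRay h P Q ↔ CrossesRay h' P Q)) := by
  have hl' : IsLink G f h' h := by
    obtain ⟨P, Q, hadj, hP, hQ, hP', hQ', hE⟩ := hl
    exact ⟨P, Q, hadj, hP', hQ', hP, hQ, hE⟩
  have hc : ((h'.a = h.a ∧ h'.b = h.b) ∨
      (h'.a = h.a ∧ h'.b = h.b + 1) ∨ (h'.a = h.a + 1 ∧ h'.b = h.b) ∨
      (h'.a = h.a + 1 ∧ h'.b = h.b - 1)) ∨ (h.a = h'.a ∧ h.b = h'.b) ∨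
      (h.a = h'.a ∧ h.b = h'.b + 1) ∨ (h.a = h'.a + 1 ∧ h.b = h'.b) ∨
      (h.a = h'.a + 1 ∧ h.b = h'.b - 1) := by
    obtain ⟨P, Q, hadj, hP, hQ, hP', hQ', -⟩ := hl
    have s1 := h.sum_eq
    have s2 := h'.sum_eq
    rw [hexGrid_adj_iff] at hadj
    simp only [Incident] at hP hQ hP' hQ'
    rcases hadj with h1 | h1 | h1 | h1 | h1 | h1 <;> omega
  rcases hc with hc | hc
  · exact exists_potential_of_isLink_aux hl hc
  · obtain ⟨φ, hφ⟩ := exists_potential_of_isLink_aux hl' hc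
    exact ⟨φ, fun P Q hPQ hE => (hφ P Q hPQ hE).trans iff_comm⟩

/-- Potentials add modulo 2 along a chain of links; `φ P ↔ ψ P` is this sum up to complement, which
does not affect the cut. -/
theorem exists_potential {f : V → HexVertex} {h h' : HexCell}
    (hl : Relation.ReflTransGen (IsLink G f) h h') :
    ∃ φ : HexVertex → Prop, ∀ P Q, hexGrid.Adj P Q → IsEdgeImage G f P Q →
      ((φ P ↔ φ Q) ↔ (CrossesRay h P Q ↔ CrossesRay h' P Q)) := by
  induction hl with
  | refl => exact ⟨fun _ => True, fun _ _ _ _ => by simp⟩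
  | tail _ hs ih =>
    obtain ⟨φ, hφ⟩ := ih
    obtain ⟨ψ, hψ⟩ := exists_potential_of_isLink hs
    refine ⟨fun P => φ P ↔ ψ P, fun P Q hPQ hE => ?_⟩
    have h1 := hφ P Q hPQ hE
    have h2 := hψ P Q hPQ hE
    grind

/-! ### Cuts of a graph with a chart -/

namespace Chart

variable {V : Type*} {G : SimpleGraph V}

/-- Each edge changes one coordinate by one. This lower bound is what makes the sides of strips
geodesic. -/
theorem natAbs_le_dist (χ : Chart G) (hG : G.Connected) (p q : V) :
    ((χ.toFun p).x - (χ.toFun q).x).natAbs + ((χ.toFun p).y - (χ.toFun q).y).natAbs +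
      ((χ.toFun p).z - (χ.toFun q).z).natAbs ≤ G.dist p q := by
  obtain ⟨w, hw⟩ := hG.exists_walk_length_eq_dist p q
  rw [← hw]
  clear hw
  induction w with
  | nil => simp
  | @cons a b c hab w ih =>
    have := χ.adj _ _ hab
    rw [hexGrid_adj_iff] at this
    rw [SimpleGraph.Walk.length_cons]
    rcases this with h | h | h | h | h | h <;> omega

/-- The hexagon `⟨a, q, -1 - a - q⟩` is full. -/
def FullAt (χ : Chart G) (a q : ℤ) : Prop := IsFull G χ.toFun ⟨a, q, -1 - a - q, by omega⟩

theorem FullAt.exists_adj {χ : Chart G} {a q : ℤ} (h : χ.FullAt a q) {x y z x' y' z' : ℤ}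
    (hs : x + y + z = 0 ∨ x + y + z = 1) (hs' : x' + y' + z' = 0 ∨ x' + y' + z' = 1)
    (hP : (a ≤ x ∧ x ≤ a + 1) ∧ (q ≤ y ∧ y ≤ q + 1) ∧ (-1 - a - q ≤ z ∧ z ≤ - a - q))
    (hQ : (a ≤ x' ∧ x' ≤ a + 1) ∧ (q ≤ y' ∧ y' ≤ q + 1) ∧ (-1 - a - q ≤ z' ∧ z' ≤ - a - q))
    (hPQ : (x' - x).natAbs + (y' - y).natAbs + (z' - z).natAbs = 1) :
    ∃ s t, χ.toFun s = ⟨x, y, z, hs⟩ ∧ χ.toFun t = ⟨x', y', z', hs'⟩ ∧ G.Adj s t := by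
  refine h ⟨x, y, z, hs⟩ ⟨x', y', z', hs'⟩ ?_ ?_ ?_
  · simp only [Incident]; omega
  · simp only [Incident]; omega
  · change |x - x'| + |y - y'| + |z - z'| = 1
    simp only [Int.abs_eq_natAbs]
    omega

/-- Reachability through vertices whose images satisfy `B`. -/
def Joined (χ : Chart G) (B : HexVertex → Prop) : V → V → Prop :=
  Relation.ReflTransGen fun s t => G.Adj s t ∧ B (χ.toFun s) ∧ B (χ.toFun t)

theorem Joined.symm {χ : Chart G} {B : HexVertex → Prop} {s t : V} (h : χ.Joined B s t) :
    χ.Joined B t s := by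
  induction h with
  | refl => exact Relation.ReflTransGen.refl
  | tail _ h ih => exact Relation.ReflTransGen.head ⟨h.1.symm, h.2.2, h.2.1⟩ ih

theorem Joined.trans {χ : Chart G} {B : HexVertex → Prop} {s t r : V} (h : χ.Joined B s t)
    (h' : χ.Joined B t r) : χ.Joined B s r :=
  Relation.ReflTransGen.trans h h'

theorem Joined.of_adj {χ : Chart G} {B : HexVertex → Prop} {s t : V} (h : G.Adj s t)
    (hs : B (χ.toFun s)) (ht : B (χ.toFun t)) : χ.Joined B s t :=
  Relation.ReflTransGen.single ⟨h, hs, ht⟩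

/-- A vertex is determined by its image. -/
theorem eq_of_coord (χ : Chart G) {p q : V} (hx : (χ.toFun p).x = (χ.toFun q).x)
    (hy : (χ.toFun p).y = (χ.toFun q).y) (hz : (χ.toFun p).z = (χ.toFun q).z) : p = q :=
  χ.inj (HexVertex.ext hx hy hz)

/-- The two sides of a strip of full hexagons are paths. -/
theorem strip_aux (χ : Chart G) (hG : G.Connected) {a t e : ℤ} (he : e = 0 ∨ e = 1) (n : ℕ)
    {B : HexVertex → Prop} {p p' : V}
    (hfull : ∀ q, t ≤ q → q < t + n → χ.FullAt a q)
    (hp : (χ.toFun p).x = a + e ∧ (χ.toFun p).y = t ∧ (χ.toFun p).z = -a - t)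
    (hp' : (χ.toFun p').x = a + e ∧ (χ.toFun p').y = t + n ∧ (χ.toFun p').z = -a - t - n)
    (hB : ∀ P : HexVertex, P.x = a + e → t ≤ P.y → P.y ≤ t + n → -a - t - n ≤ P.z →
      P.z ≤ -a - t → B P) :
    χ.Joined B p p' ∧ G.dist p p' ≤ 2 * n := by
  induction n generalizing p' with
  | zero =>
    have : p = p' := χ.eq_of_coord (by omega) (by omega) (by omega)
    subst this
    exact ⟨Relation.ReflTransGen.refl, by simp⟩
  | succ n ih =>
    push_cast at hfull hp' hB
    have hF := hfull (t + n) (by omega) (by omega)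
    -- Two edges per hexagon. For `e = 0` the coordinate sum is 0, so `y` is raised before `z` is
    -- lowered; for `e = 1` the sum is 1 and the order is reversed.
    obtain ⟨r, m, hr, hm, hrm⟩ := hF.exists_adj (x := a + e) (y := t + n) (z := -a - t - n)
      (x' := a + e) (y' := t + n + (1 - e)) (z' := -a - t - n - e)
      (by omega) (by omega) (by omega) (by omega) (by omega)
    obtain ⟨m', r', hm', hr', hrm'⟩ := hF.exists_adj (x := a + e) (y := t + n + (1 - e))
      (z := -a - t - n - e) (x' := a + e) (y' := t + n + 1) (z' := -a - t - n - 1)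
      (by omega) (by omega) (by omega) (by omega) (by omega)
    obtain rfl : m = m' := χ.inj (hm.trans hm'.symm)
    obtain rfl : p' = r' := χ.eq_of_coord (by simp [hr', hp']) (by simp [hr', hp']; ring)
      (by simp [hr', hp']; ring)
    have h1 := ih (p' := r) (fun q h1 h2 => hfull q h1 (by omega)) (by simp [hr])
      (fun P h1 h2 h3 h4 h5 => hB P h1 h2 (by omega) (by omega) h5)
    have hBr : B (χ.toFun r) := by rw [hr]; apply hB <;> dsimp only <;> omega
    have hBm : B (χ.toFun m) := by rw [hm]; apply hB <;> dsimp only <;> omega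
    have hBp : B (χ.toFun p') := by rw [hr']; apply hB <;> dsimp only <;> omega
    refine ⟨(h1.1.trans (Joined.of_adj hrm hBr hBm)).trans (Joined.of_adj hrm' hBm hBp), ?_⟩
    have h2 := h1.2
    have h3 := hG.dist_triangle (u := p) (v := r) (w := p')
    have h4 := hG.dist_triangle (u := r) (v := m) (w := p')
    have h5 := SimpleGraph.dist_eq_one_iff_adj.2 hrm
    have h6 := SimpleGraph.dist_eq_one_iff_adj.2 hrm'
    omega

theorem strip (χ : Chart G) (hG : G.Connected) {a e : ℤ} (he : e = 0 ∨ e = 1)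
    {B : HexVertex → Prop} {p p' : V} (hle : (χ.toFun p).y ≤ (χ.toFun p').y)
    (hfull : ∀ q, (χ.toFun p).y ≤ q → q < (χ.toFun p').y → χ.FullAt a q)
    (hx : (χ.toFun p).x = a + e) (hz : (χ.toFun p).z = -a - (χ.toFun p).y)
    (hx' : (χ.toFun p').x = a + e) (hz' : (χ.toFun p').z = -a - (χ.toFun p').y)
    (hB : ∀ P : HexVertex, P.x = a + e → (χ.toFun p).y ≤ P.y → P.y ≤ (χ.toFun p').y →
      (χ.toFun p').z ≤ P.z → P.z ≤ (χ.toFun p).z → B P) :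
    χ.Joined B p p' ∧ (G.dist p p' : ℤ) ≤ 2 * ((χ.toFun p').y - (χ.toFun p).y) := by
  obtain ⟨n, hn⟩ := Int.le.dest hle
  have := χ.strip_aux hG (a := a) (t := (χ.toFun p).y) he n (B := B) (p := p) (p' := p')
    (fun q h1 h2 => hfull q h1 (by omega)) ⟨hx, rfl, hz⟩ ⟨hx', hn.symm, by omega⟩
    (fun P h1 h2 h3 h4 h5 => hB P h1 h2 (by omega) (by omega) (by omega))
  exact ⟨this.1, by omega⟩

theorem dist_strip (χ : Chart G) (hG : G.Connected) {a e : ℤ} (he : e = 0 ∨ e = 1) {p p' : V}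
    (hfull : ∀ q, ((χ.toFun p).y ≤ q ∧ q < (χ.toFun p').y) ∨
      ((χ.toFun p').y ≤ q ∧ q < (χ.toFun p).y) → χ.FullAt a q)
    (hx : (χ.toFun p).x = a + e) (hz : (χ.toFun p).z = -a - (χ.toFun p).y)
    (hx' : (χ.toFun p').x = a + e) (hz' : (χ.toFun p').z = -a - (χ.toFun p').y) :
    G.dist p p' = 2 * ((χ.toFun p').y - (χ.toFun p).y).natAbs := by
  have h1 := χ.natAbs_le_dist hG p p'
  rcases le_total (χ.toFun p).y (χ.toFun p').y with h | h
  · have := (χ.strip hG he (B := fun _ => True) h (fun q h1 h2 => hfull q (Or.inl ⟨h1, h2⟩))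
      hx hz hx' hz' (fun _ _ _ _ _ _ => trivial)).2
    omega
  · have := (χ.strip hG he (B := fun _ => True) h (fun q h1 h2 => hfull q (Or.inr ⟨h1, h2⟩))
      hx' hz' hx hz (fun _ _ _ _ _ _ => trivial)).2
    rw [SimpleGraph.dist_comm] at this
    omega

/-! ### Cuts along strips and their halfspaces -/

theorem exists_not_fullAt (χ : Chart G) (a b : ℤ) {d : ℤ} (hd : d ≠ 0) :
    ∃ n : ℕ, ¬ χ.FullAt a (b + d * n) := by
  by_contra! h
  have hinj : Function.Injective
      (fun n : ℕ => (⟨a, b + d * n, -1 - a - (b + d * n), by omega⟩ : HexCell)) := by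
    intro m n hmn
    have := congrArg HexCell.b hmn
    simpa [hd] using this
  exact Set.infinite_of_injective_forall_mem hinj h χ.finite_full

/-- The cut of the edge `uw`: a distance criterion that separates the graph exactly along a
strip of full hexagons. -/
theorem exists_cut (χ : Chart G) {u w : V} (huw : G.Adj u w)
    (hx : (χ.toFun w).x = (χ.toFun u).x + 1) :
    ∃ f : V → Prop, ¬ (f u ↔ f w) ∧ ∀ s t, G.Adj s t → ¬ (f s ↔ f t) →
      (χ.toFun s).x + (χ.toFun t).x = 2 * (χ.toFun u).x + 1 ∧
      ∀ q, ((χ.toFun u).y ≤ q ∧ q < (χ.toFun s).y) ∨ ((χ.toFun s).y ≤ q ∧ q < (χ.toFun u).y) →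
        χ.FullAt (χ.toFun u).x q := by
  classical
  set a := (χ.toFun u).x with ha
  set b := (χ.toFun u).y with hb
  -- The rung at height `b` separates the hexagons with second coordinate `b - 1` and `b`, so the
  -- downward search starts at `b - 1`. The rays from the two non-full hexagons found differ exactly
  -- in the rungs of heights `b - n` to `b + m`.
  have hup := χ.exists_not_fullAt a b (d := 1) (by simp)
  have hdown := χ.exists_not_fullAt a (b - 1) (d := -1) (by simp)
  set m := Nat.find hup with hm
  set n := Nat.find hdown with hn
  obtain ⟨φ, hφ⟩ := exists_potential (χ.linked _ _ (Nat.find_spec hdown) (Nat.find_spec hup))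
  have hφ' : ∀ s t, G.Adj s t → (¬ (φ (χ.toFun s) ↔ φ (χ.toFun t)) ↔
      (χ.toFun s).x + (χ.toFun t).x = 2 * a + 1 ∧ b - n ≤ (χ.toFun s).y ∧
        (χ.toFun s).y ≤ b + m) := by
    intro s t hst
    have := hφ _ _ (χ.adj s t hst) ⟨s, t, rfl, rfl, hst⟩
    rw [this]
    simp only [CrossesRay, ← hm, ← hn]
    omega
  refine ⟨fun s => φ (χ.toFun s), (hφ' u w huw).2 (by omega), fun s t hst hne => ?_⟩
  have h1 := (hφ' s t hst).1 hne
  refine ⟨h1.1, fun q hq => ?_⟩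
  rcases hq with hq | hq
  · have := Nat.find_min hup (m := (q - b).toNat) (by omega)
    rw [not_not] at this
    convert this using 1
    omega
  · have := Nat.find_min hdown (m := (b - 1 - q).toNat) (by omega)
    rw [not_not] at this
    convert this using 1
    omega

/-- Both sides of a strip are geodesics with two edges per hexagon, so a rung `st` of the cut
satisfies `d(s,u) = d(t,w)`. By `dist_lt_dist_of_cut` the two sides of the cut are then the
halfspaces of `uw`, and an edge between the halfspaces is a rung. -/
theorem cut_x (χ : Chart G) (hG : G.Connected) {u w : V} (huw : G.Adj u w)
    (hx : (χ.toFun w).x = (χ.toFun u).x + 1) :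
    (∀ s, G.dist s u < G.dist s w ∨ G.dist s w < G.dist s u) ∧
    ∀ s t, G.Adj s t → G.dist s u < G.dist s w → G.dist t w < G.dist t u →
      ((χ.toFun s).x = (χ.toFun u).x ∧ (χ.toFun t).x = (χ.toFun u).x + 1 ∧
        (χ.toFun t).y = (χ.toFun s).y ∧ (χ.toFun t).z = (χ.toFun s).z) ∧
      ∀ q, ((χ.toFun u).y ≤ q ∧ q < (χ.toFun s).y) ∨ ((χ.toFun s).y ≤ q ∧ q < (χ.toFun u).y) →
        χ.FullAt (χ.toFun u).x q := by
  obtain ⟨f, hf, hcut⟩ := χ.exists_cut huw hx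
  have key : ∀ s t, G.Adj s t → ¬ (f s ↔ f t) →
      (χ.toFun t).y = (χ.toFun s).y ∧ (χ.toFun t).z = (χ.toFun s).z ∧
      (((χ.toFun s).x = (χ.toFun u).x ∧ (χ.toFun t).x = (χ.toFun u).x + 1 ∧
        G.dist s u = G.dist t w ∧ G.dist s u < G.dist s w) ∨
      ((χ.toFun s).x = (χ.toFun u).x + 1 ∧ (χ.toFun t).x = (χ.toFun u).x ∧
        G.dist s u = G.dist t w ∧ G.dist s w < G.dist s u)) := by
    intro s t hst hne
    obtain ⟨h1, hfull⟩ := hcut s t hst hne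
    have hadj := (hexGrid_adj_iff _ _).1 (χ.adj s t hst)
    have huw' := (hexGrid_adj_iff _ _).1 (χ.adj u w huw)
    have hy : (χ.toFun t).y = (χ.toFun s).y ∧ (χ.toFun t).z = (χ.toFun s).z := by
      rcases hadj with h | h | h | h | h | h <;> omega
    have hy' : (χ.toFun w).y = (χ.toFun u).y ∧ (χ.toFun w).z = (χ.toFun u).z := by
      rcases huw' with h | h | h | h | h | h <;> omega
    have hs := (χ.toFun s).sum_eq
    have ht := (χ.toFun t).sum_eq
    have hu := (χ.toFun u).sum_eq
    have hw := (χ.toFun w).sum_eq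
    have e1 := SimpleGraph.dist_eq_one_iff_adj.2 hst
    have e2 := SimpleGraph.dist_eq_one_iff_adj.2 huw
    have b1 := χ.natAbs_le_dist hG s w
    have b2 := χ.natAbs_le_dist hG s u
    have b3 := χ.natAbs_le_dist hG t w
    have t1 := hG.dist_triangle (u := s) (v := t) (w := u)
    have t2 := hG.dist_triangle (u := t) (v := s) (w := w)
    rw [SimpleGraph.dist_comm (u := t) (v := s)] at t2
    refine ⟨hy.1, hy.2, ?_⟩
    have hor : ((χ.toFun s).x = (χ.toFun u).x ∧ (χ.toFun t).x = (χ.toFun u).x + 1) ∨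
      ((χ.toFun s).x = (χ.toFun u).x + 1 ∧ (χ.toFun t).x = (χ.toFun u).x) := by
      rcases hadj with h | h | h | h | h | h <;> omega
    clear hadj huw'
    rcases hor with h | h
    · have d1 := χ.dist_strip hG (a := (χ.toFun u).x) (e := 0) (p := s) (p' := u) (by omega)
        (fun q hq => hfull q hq.symm) (by omega) (by omega) (by omega) (by omega)
      have d2 := χ.dist_strip hG (a := (χ.toFun u).x) (e := 1) (p := t) (p' := w) (by omega)
        (fun q hq => hfull q (by omega)) (by omega) (by omega) (by omega) (by omega)
      left
      omega
    · have d1 := χ.dist_strip hG (a := (χ.toFun u).x) (e := 0) (p := t) (p' := u) (by omega)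
        (fun q hq => hfull q (by omega)) (by omega) (by omega) (by omega) (by omega)
      have d2 := χ.dist_strip hG (a := (χ.toFun u).x) (e := 1) (p := s) (p' := w) (by omega)
        (fun q hq => hfull q (by omega)) (by omega) (by omega) (by omega) (by omega)
      right
      omega
  have hside : ∀ s, (f s ↔ f u) → G.dist s u < G.dist s w := fun s hs =>
    dist_lt_dist_of_cut hG hf (fun p q hpq hne => by
      rcases (key p q hpq hne).2.2 with h | h <;> exact h.2.2.1) hs
  have hside' : ∀ s, ¬ (f s ↔ f u) → G.dist s w < G.dist s u := fun s hs =>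
    dist_lt_dist_of_cut hG (fun h => hf h.symm) (fun p q hpq hne => by
      rcases (key q p hpq.symm (fun h => hne h.symm)).2.2 with h | h <;>
        exact h.2.2.1.symm) (by tauto)
  refine ⟨fun s => (em (f s ↔ f u)).imp (hside s) (hside' s), fun s t hst hs ht => ?_⟩
  have hfs : (f s ↔ f u) := by
    by_contra h
    exact absurd (hside' s h) (by omega)
  have hft : ¬ (f t ↔ f u) := fun h => absurd (hside t h) (by omega)
  have hne : ¬ (f s ↔ f t) := fun h => hft (h.symm.trans hfs)
  have hk := key s t hst hne
  exact ⟨by omega, (hcut s t hst hne).2⟩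

theorem cut_x_coord (χ : Chart G) (hG : G.Connected) {u w : V} (huw : G.Adj u w)
    (hx : (χ.toFun u).x ≠ (χ.toFun w).x) {s t : V} (hst : G.Adj s t)
    (hs : G.dist s u < G.dist s w) (ht : G.dist t w < G.dist t u) :
    (χ.toFun s).x = (χ.toFun u).x ∧ (χ.toFun t).x = (χ.toFun w).x ∧
      (χ.toFun t).y = (χ.toFun s).y ∧ (χ.toFun t).z = (χ.toFun s).z := by
  have hadj := (hexGrid_adj_iff _ _).1 (χ.adj u w huw)
  have h : (χ.toFun w).x = (χ.toFun u).x + 1 ∨ (χ.toFun u).x = (χ.toFun w).x + 1 := by omega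
  rcases h with h | h
  · have := ((χ.cut_x hG huw h).2 s t hst hs ht).1
    omega
  · have := ((χ.cut_x hG huw.symm h).2 t s hst.symm ht hs).1
    omega

theorem cut_y_coord (χ : Chart G) (hG : G.Connected) {u w : V} (huw : G.Adj u w)
    (hx : (χ.toFun u).y ≠ (χ.toFun w).y) {s t : V} (hst : G.Adj s t)
    (hs : G.dist s u < G.dist s w) (ht : G.dist t w < G.dist t u) :
    (χ.toFun s).y = (χ.toFun u).y ∧ (χ.toFun t).y = (χ.toFun w).y ∧
      (χ.toFun t).z = (χ.toFun s).z ∧ (χ.toFun t).x = (χ.toFun s).x :=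
  (χ.comp .rot).cut_x_coord hG huw hx hst hs ht

theorem dist_lt_or_lt_of_x (χ : Chart G) (hG : G.Connected) {u w : V} (huw : G.Adj u w)
    (hx : (χ.toFun u).x ≠ (χ.toFun w).x) (s : V) :
    G.dist s u < G.dist s w ∨ G.dist s w < G.dist s u := by
  have hadj := (hexGrid_adj_iff _ _).1 (χ.adj u w huw)
  have h : (χ.toFun w).x = (χ.toFun u).x + 1 ∨ (χ.toFun u).x = (χ.toFun w).x + 1 := by omega
  rcases h with h | h
  · exact (χ.cut_x hG huw h).1 s
  · exact ((χ.cut_x hG huw.symm h).1 s).symm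

theorem exists_ne_coord (χ : Chart G) {u w : V} (huw : G.Adj u w) :
    (χ.toFun u).x ≠ (χ.toFun w).x ∨ (χ.toFun u).y ≠ (χ.toFun w).y ∨
      (χ.toFun u).z ≠ (χ.toFun w).z := by
  by_contra! h
  exact huw.ne (χ.eq_of_coord h.1 h.2.1 h.2.2)

/-- A graph with a chart is bipartite. -/
theorem dist_lt_or_lt (χ : Chart G) (hG : G.Connected) {u w : V} (huw : G.Adj u w) (s : V) :
    G.dist s u < G.dist s w ∨ G.dist s w < G.dist s u := by
  rcases χ.exists_ne_coord huw with h | h | h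
  · exact χ.dist_lt_or_lt_of_x hG huw h s
  · exact (χ.comp .rot).dist_lt_or_lt_of_x hG huw h s
  · exact ((χ.comp .rot).comp .rot).dist_lt_or_lt_of_x hG huw h s

/-- A vertex that can be reached from `u` without meeting the level of `w` lies on the side
of `u` of the edge `uw`. -/
theorem dist_lt_of_joined_x (χ : Chart G) (hG : G.Connected) {u w : V} (huw : G.Adj u w)
    (hx : (χ.toFun u).x ≠ (χ.toFun w).x) {B : HexVertex → Prop} {s : V} (hJ : χ.Joined B u s)
    (hB : ∀ P, B P → P.x ≠ (χ.toFun w).x) : G.dist s u < G.dist s w := by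
  by_contra h
  have h0 : G.dist u u < G.dist u w := by
    rw [SimpleGraph.dist_self]
    exact hG.pos_dist_of_ne huw.ne
  obtain ⟨p, q, ⟨hpq, -, hq⟩, hp', hq'⟩ := exists_step_of_reflTransGen hJ
    (P := fun x => G.dist x u < G.dist x w) h0 h
  exact hB _ hq (χ.cut_x_coord hG huw hx hpq hp'
    ((χ.dist_lt_or_lt hG huw q).resolve_left hq')).2.1

theorem dist_lt_of_joined_y (χ : Chart G) (hG : G.Connected) {u w : V} (huw : G.Adj u w)
    (hx : (χ.toFun u).y ≠ (χ.toFun w).y) {B : HexVertex → Prop} {s : V} (hJ : χ.Joined B u s)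
    (hB : ∀ P, B P → P.y ≠ (χ.toFun w).y) : G.dist s u < G.dist s w :=
  (χ.comp .rot).dist_lt_of_joined_x hG huw hx
    (B := fun P => B ⟨P.z, P.x, P.y, by have := P.sum_eq; omega⟩) hJ (fun _ h => hB _ h)

theorem dist_lt_of_joined_z (χ : Chart G) (hG : G.Connected) {u w : V} (huw : G.Adj u w)
    (hx : (χ.toFun u).z ≠ (χ.toFun w).z) {B : HexVertex → Prop} {s : V} (hJ : χ.Joined B u s)
    (hB : ∀ P, B P → P.z ≠ (χ.toFun w).z) : G.dist s u < G.dist s w :=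
  (χ.comp .rot).dist_lt_of_joined_y hG huw hx
    (B := fun P => B ⟨P.z, P.x, P.y, by have := P.sum_eq; omega⟩) hJ (fun _ h => hB _ h)

/-! ### Facing edges and exchange inequalities -/

theorem dist_le_of_adj (hG : G.Connected) {p q : V} (h : G.Adj p q) (r : V) :
    G.dist r p ≤ G.dist r q + 1 ∧ G.dist r q ≤ G.dist r p + 1 := by
  have h1 := hG.dist_triangle (u := r) (v := p) (w := q)
  have h2 := hG.dist_triangle (u := r) (v := q) (w := p)
  have h3 := SimpleGraph.dist_eq_one_iff_adj.2 h
  have h4 := SimpleGraph.dist_comm (G := G) (u := p) (v := q)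
  omega

/-- If a vertex lies behind both of two edges that face each other, then some edge equivalent to
the second one lies behind the first one. -/
theorem exists_crossing (χ : Chart G) (hG : G.Connected) {u w v w' : V} (huw : G.Adj u w)
    (hvw : G.Adj v w') (hu : G.dist u w' < G.dist u v) {s : V}
    (hs : ¬ G.dist s w' + G.dist s w ≤ G.dist s v + G.dist s u) :
    ∃ t t', G.Adj t t' ∧ G.dist t u < G.dist t w ∧ G.dist t v < G.dist t w' ∧
      G.dist t' w' < G.dist t' v := by
  -- Each of the two moves changes the distance to `s` by exactly one, so the sum grows only if both
  -- distances grow.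
  have a1 := dist_le_of_adj hG huw s
  have a2 := dist_le_of_adj hG hvw s
  have hsu : G.dist s u < G.dist s w := by
    rcases χ.dist_lt_or_lt hG huw s with h | h <;> omega
  have hsv : G.dist s v < G.dist s w' := by
    rcases χ.dist_lt_or_lt hG hvw s with h | h <;> omega
  obtain ⟨t, t', htt, ht, ht', hd⟩ := exists_adj_of_geodesic hG
    (P := fun x => G.dist x v < G.dist x w') (a := s) (b := u) hsv (by omega)
  refine ⟨t, t', htt, ?_, ht, (χ.dist_lt_or_lt hG hvw t').resolve_left ht'⟩
  -- As `t` lies on a geodesic from `s` to `u`, being nearer to `w` would make `s` nearer to `w` as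
  -- well.
  refine (χ.dist_lt_or_lt hG huw t).resolve_right fun h => ?_
  have b1 := hG.dist_triangle (u := s) (v := t) (w := w)
  have b2 := hG.dist_triangle (u := t) (v := t') (w := u)
  have b3 := SimpleGraph.dist_eq_one_iff_adj.2 htt
  omega

theorem dist_add_dist_le_of_parallel_aux (χ : Chart G) (hG : G.Connected) {u w v w' : V}
    (huw : G.Adj u w) (hvw : G.Adj v w') (hu : G.dist u w' < G.dist u v)
    (hv : G.dist v w < G.dist v u) (hx : (χ.toFun w').x = (χ.toFun v).x + 1)
    (hx' : (χ.toFun u).x ≠ (χ.toFun w).x) (s : V) :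
    G.dist s w' + G.dist s w ≤ G.dist s v + G.dist s u := by
  by_contra hs
  obtain ⟨t, t', htt, htu, htv, htw⟩ := χ.exists_crossing hG huw hvw hu hs
  obtain ⟨hc, hfull⟩ := (χ.cut_x hG hvw hx).2 t t' htt htv htw
  have hadj := (hexGrid_adj_iff _ _).1 (χ.adj v w' hvw)
  have hadj' := (hexGrid_adj_iff _ _).1 (χ.adj t t' htt)
  have s1 := (χ.toFun v).sum_eq
  have s2 := (χ.toFun w').sum_eq
  have s3 := (χ.toFun t).sum_eq
  have s4 := (χ.toFun t').sum_eq
  have hv0 : (χ.toFun v).z = -(χ.toFun v).x - (χ.toFun v).y := by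
    rcases hadj with h | h | h | h | h | h <;> omega
  have ht0 : (χ.toFun t).z = -(χ.toFun v).x - (χ.toFun t).y := by omega
  -- The side of the strip of `vw'` leads from `t`, behind `uw`, to `v`, beyond it, at constant `x`.
  -- But crossing the cut of `uw` requires a change of `x`.
  have hJ : χ.Joined (fun P => P.x = (χ.toFun v).x) t v := by
    rcases le_total (χ.toFun t).y (χ.toFun v).y with h | h
    · exact (χ.strip hG (Or.inl rfl) h (fun q h1 h2 => hfull q (Or.inr ⟨h1, h2⟩)) (by omega)
        (by omega) (by omega) hv0 (fun P h _ _ _ _ => by omega)).1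
    · exact (χ.strip hG (Or.inl rfl) h (fun q h1 h2 => hfull q (Or.inl ⟨h1, h2⟩)) (by omega)
        (by omega) (by omega) ht0 (fun P h _ _ _ _ => by omega)).1.symm
  obtain ⟨p, q, ⟨hpq, hp, hq⟩, hpu, hqu⟩ := exists_step_of_reflTransGen hJ
    (P := fun x => G.dist x u < G.dist x w) htu (by omega)
  have := χ.cut_x_coord hG huw hx' hpq hpu ((χ.dist_lt_or_lt hG huw q).resolve_left hqu)
  omega

/-- Two parallel edges that face each other: moving both end vertices towards each other does
not increase the sum of distances. -/
theorem dist_add_dist_le_of_parallel_x (χ : Chart G) (hG : G.Connected) {u w v w' : V}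
    (huw : G.Adj u w) (hvw : G.Adj v w') (hu : G.dist u w' < G.dist u v)
    (hv : G.dist v w < G.dist v u) (hx : (χ.toFun v).x ≠ (χ.toFun w').x)
    (hx' : (χ.toFun u).x ≠ (χ.toFun w).x) (s : V) :
    G.dist s w' + G.dist s w ≤ G.dist s v + G.dist s u := by
  have hadj := (hexGrid_adj_iff _ _).1 (χ.adj v w' hvw)
  have h : (χ.toFun w').x = (χ.toFun v).x + 1 ∨ -(χ.toFun w').x = -(χ.toFun v).x + 1 := by omega
  rcases h with h | h
  · exact χ.dist_add_dist_le_of_parallel_aux hG huw hvw hu hv h hx' s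
  · exact (χ.comp .inv).dist_add_dist_le_of_parallel_aux hG huw hvw hu hv h
      (fun e => hx' (neg_injective e)) s

theorem dist_add_dist_le_of_parallel_y (χ : Chart G) (hG : G.Connected) {u w v w' : V}
    (huw : G.Adj u w) (hvw : G.Adj v w') (hu : G.dist u w' < G.dist u v)
    (hv : G.dist v w < G.dist v u) (hx : (χ.toFun v).y ≠ (χ.toFun w').y)
    (hx' : (χ.toFun u).y ≠ (χ.toFun w).y) (s : V) :
    G.dist s w' + G.dist s w ≤ G.dist s v + G.dist s u :=
  (χ.comp .rot).dist_add_dist_le_of_parallel_x hG huw hvw hu hv hx hx' s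

theorem dist_add_dist_le_of_parallel_z (χ : Chart G) (hG : G.Connected) {u w v w' : V}
    (huw : G.Adj u w) (hvw : G.Adj v w') (hu : G.dist u w' < G.dist u v)
    (hv : G.dist v w < G.dist v u) (hx : (χ.toFun v).z ≠ (χ.toFun w').z)
    (hx' : (χ.toFun u).z ≠ (χ.toFun w).z) (s : V) :
    G.dist s w' + G.dist s w ≤ G.dist s v + G.dist s u :=
  ((χ.comp .rot).comp .rot).dist_add_dist_le_of_parallel_x hG huw hvw hu hv hx hx' s

/-- Along a strip of full hexagons, a property that holds at one end and fails at the other one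
changes within some hexagon. -/
theorem exists_rung (χ : Chart G) {a : ℤ} {v : V} {P : V → Prop}
    (hv : (χ.toFun v).x = a ∧ (χ.toFun v).z = -a - (χ.toFun v).y) (hPv : P v) (n : ℕ) {t : V}
    (ht : (χ.toFun t).x = a ∧ (χ.toFun t).z = -a - (χ.toFun t).y)
    (hn : (χ.toFun v).y = (χ.toFun t).y + n) (hPt : ¬ P t)
    (hfull : ∀ q, (χ.toFun t).y ≤ q → q < (χ.toFun v).y → χ.FullAt a q) :
    ∃ p q, P p ∧ ¬ P q ∧ ((χ.toFun p).x = a ∧ (χ.toFun p).z = -a - (χ.toFun p).y) ∧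
      ((χ.toFun q).x = a ∧ (χ.toFun q).z = -a - (χ.toFun q).y) ∧
      (χ.toFun p).y = (χ.toFun q).y + 1 ∧ (χ.toFun p).y ≤ (χ.toFun v).y ∧
      (χ.toFun t).y ≤ (χ.toFun q).y := by
  induction n generalizing t with
  | zero =>
    have : t = v := χ.eq_of_coord (by omega) (by omega) (by omega)
    exact absurd hPv (this ▸ hPt)
  | succ n ih =>
    push_cast at hn
    obtain ⟨r, -, hr, -, -⟩ := (hfull _ le_rfl (by omega)).exists_adj (x := a)
      (y := (χ.toFun t).y + 1) (z := -a - ((χ.toFun t).y + 1)) (x' := a + 1)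
      (y' := (χ.toFun t).y + 1) (z' := -a - ((χ.toFun t).y + 1))
      (by omega) (by omega) (by omega) (by omega) (by omega)
    have hry : (χ.toFun r).y = (χ.toFun t).y + 1 := by rw [hr]
    have hr' : (χ.toFun r).x = a ∧ (χ.toFun r).z = -a - (χ.toFun r).y := by simp [hr]
    by_cases hPr : P r
    · exact ⟨r, t, hPr, hPt, hr', ht, hry, by omega, le_rfl⟩
    · obtain ⟨p, q, h1, h2, h3, h4, h5, h6, h7⟩ := ih hr' (by omega) hPr
        (fun q hq hq' => hfull q (by omega) hq')
      exact ⟨p, q, h1, h2, h3, h4, h5, h6, by omega⟩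

/-- If the edge `n₀n₁` is separated by the edge `uw`, then conversely. -/
theorem dist_lt_of_crossing (χ : Chart G) (hG : G.Connected) {u w p q : V} (huw : G.Adj u w)
    (hpq : G.Adj p q) (hp : G.dist p u < G.dist p w) (hq : G.dist q w < G.dist q u) :
    G.dist u p < G.dist u q ∧ G.dist w q < G.dist w p := by
  have h1 := dist_le_of_adj hG huw p
  have h2 := dist_le_of_adj hG huw q
  have h3 := dist_le_of_adj hG hpq u
  have h4 := dist_le_of_adj hG hpq w
  have h5 := χ.dist_lt_or_lt hG hpq u
  have h6 := χ.dist_lt_or_lt hG hpq w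
  simp only [SimpleGraph.dist_comm (v := u), SimpleGraph.dist_comm (v := w)] at *
  omega

/-! ### Replacement pairs for distant vertices -/

/-- As `n₀n₁` crosses the cut of `uw`, the edge `uw` is a rung of the strip of `n₀n₁`, hence a
`z`-edge. The `z`-edge `vc` of the hexagon below `v` faces it: from `c` one reaches `u` along the
two strips while staying above the `z`-level of `v`. The pair is `c, w`. -/
theorem exists_closer_of_rung_z (χ : Chart G) (hG : G.Connected) {u w v n₀ n₁ : V}
    (huw : G.Adj u w) (hu2 : 1 < G.dist u v)
    (hv : G.dist v w < G.dist v u)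
    (hv0 : (χ.toFun v).z = -(χ.toFun v).x - (χ.toFun v).y)
    (hn0 : (χ.toFun n₀).x = (χ.toFun v).x ∧ (χ.toFun n₀).z = -(χ.toFun v).x - (χ.toFun n₀).y)
    (hn1 : (χ.toFun n₁).x = (χ.toFun v).x ∧ (χ.toFun n₁).y = (χ.toFun n₀).y ∧
      (χ.toFun n₁).z = (χ.toFun n₀).z + 1)
    (h01 : G.Adj n₀ n₁) (hle : (χ.toFun n₀).y ≤ (χ.toFun v).y)
    (hfull : ∀ q, (χ.toFun n₀).y - 1 ≤ q → q < (χ.toFun v).y → χ.FullAt (χ.toFun v).x q)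
    (hPn0 : G.dist n₀ w < G.dist n₀ u) (hPn1 : G.dist n₁ u < G.dist n₁ w) :
    ∃ a b, G.dist a u < G.dist u v ∧ G.dist a v < G.dist u v ∧
      ∀ s, G.dist s a + G.dist s b ≤ G.dist s u + G.dist s v := by
  set a := (χ.toFun v).x with ha
  set b := (χ.toFun v).y with hb
  have hcr := χ.dist_lt_of_crossing hG huw h01.symm hPn1 hPn0
  obtain ⟨hz, hzfull⟩ := ((χ.comp .rot).comp .rot).cut_x hG h01 hn1.2.2 |>.2 w u huw.symm
    hcr.2 hcr.1
  change (χ.toFun w).z = (χ.toFun n₀).z ∧ (χ.toFun u).z = (χ.toFun n₀).z + 1 ∧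
    (χ.toFun u).x = (χ.toFun w).x ∧ (χ.toFun u).y = (χ.toFun w).y at hz
  change ∀ q, ((χ.toFun n₀).x ≤ q ∧ q < (χ.toFun w).x) ∨
    ((χ.toFun w).x ≤ q ∧ q < (χ.toFun n₀).x) →
    ((χ.comp .rot).comp .rot).FullAt (χ.toFun n₀).z q at hzfull
  obtain ⟨v', c, hv', hc, hvc⟩ := (hfull (b - 1) (by omega) (by omega)).exists_adj (x := a)
    (y := b) (z := -a - b) (x' := a) (y' := b) (z' := -a - b + 1)
    (by omega) (by omega) (by omega) (by omega) (by omega)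
  obtain rfl : v = v' := χ.eq_of_coord (by simp [hv', ← ha]) (by simp [hv', ← hb])
    (by simp [hv', hv0])
  have hcx : (χ.toFun c).x = a ∧ (χ.toFun c).y = b ∧ (χ.toFun c).z = -a - b + 1 := by simp [hc]
  clear hv' hc
  have su := (χ.toFun u).sum_eq
  have sw := (χ.toFun w).sum_eq
  let B : HexVertex → Prop := fun P => -a - b + 1 ≤ P.z
  -- the edge `vc` separates `u` from `v`
  have hcn : χ.Joined B c n₁ := by
    -- If `n₀` is at the height of `v`, the crossing happens at `v` itself and `c = n₁`.
    by_cases hy : (χ.toFun n₀).y = b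
    · obtain rfl : c = n₁ := χ.eq_of_coord (by omega) (by omega) (by omega)
      exact Relation.ReflTransGen.refl
    · obtain ⟨c', r, hc', hr, hcr'⟩ := (hfull (b - 1) (by omega) (by omega)).exists_adj (x := a)
        (y := b) (z := -a - b + 1) (x' := a) (y' := b - 1) (z' := -a - b + 1)
        (by omega) (by omega) (by omega) (by omega) (by omega)
      obtain rfl : c = c' := χ.eq_of_coord (by simp [hc', hcx]) (by simp [hc', hcx])
        (by simp [hc', hcx])
      have hrx : (χ.toFun r).x = a ∧ (χ.toFun r).y = b - 1 ∧ (χ.toFun r).z = -a - b + 1 := by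
        simp [hr]
      clear hc' hr
      have hs := (χ.strip hG (a := a) (e := 0) (B := B) (p := n₀) (p' := r) (Or.inl rfl)
        (by omega) (fun q h1 h2 => hfull q (by omega) (by omega)) (by omega) (by omega)
        (by omega) (by omega) (fun P _ _ _ h _ => by simp only [B]; omega)).1
      refine (Joined.of_adj hcr' ?_ ?_).trans (hs.symm.trans (Joined.of_adj h01 ?_ ?_)) <;>
        simp only [B] <;> omega
  have hnu : χ.Joined B n₁ u := by
    change ((χ.comp .rot).comp .rot).Joined (fun P => -a - b + 1 ≤ P.x) n₁ u
    rcases le_total (χ.toFun n₀).x (χ.toFun w).x with h | h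
    · exact (((χ.comp .rot).comp .rot).strip hG (a := (χ.toFun n₀).z) (e := 1) (p := n₁)
        (p' := u) (Or.inr rfl) (show (χ.toFun n₁).x ≤ (χ.toFun u).x by omega)
        (fun q h1 h2 => hzfull q (Or.inl (by
          change (χ.toFun n₁).x ≤ q at h1
          change q < (χ.toFun u).x at h2
          omega)))
        (show (χ.toFun n₁).z = _ by omega)
        (show (χ.toFun n₁).y = -(χ.toFun n₀).z - (χ.toFun n₁).x by omega)
        (show (χ.toFun u).z = _ by omega)
        (show (χ.toFun u).y = -(χ.toFun n₀).z - (χ.toFun u).x by omega)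
        (fun P h _ _ _ _ => by omega)).1
    · exact (((χ.comp .rot).comp .rot).strip hG (a := (χ.toFun n₀).z) (e := 1) (p := u)
        (p' := n₁) (Or.inr rfl) (show (χ.toFun u).x ≤ (χ.toFun n₁).x by omega)
        (fun q h1 h2 => hzfull q (Or.inr (by
          change (χ.toFun u).x ≤ q at h1
          change q < (χ.toFun n₁).x at h2
          omega)))
        (show (χ.toFun u).z = _ by omega)
        (show (χ.toFun u).y = -(χ.toFun n₀).z - (χ.toFun u).x by omega)
        (show (χ.toFun n₁).z = _ by omega)
        (show (χ.toFun n₁).y = -(χ.toFun n₀).z - (χ.toFun n₁).x by omega)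
        (fun P h _ _ _ _ => by omega)).1.symm
  have hcu : G.dist u c < G.dist u v :=
    χ.dist_lt_of_joined_z hG hvc.symm (by omega) (hcn.trans hnu)
      (fun P h => by simp only [B] at h; omega)
  refine ⟨c, w, by rwa [SimpleGraph.dist_comm], ?_, fun s => ?_⟩
  · rw [SimpleGraph.dist_eq_one_iff_adj.2 hvc.symm]
    exact hu2
  · rw [add_comm (G.dist s u)]
    exact χ.dist_add_dist_le_of_parallel_z hG huw hvc hcu hv (by omega) (by omega) s

set_option maxHeartbeats 1600000 in
-- Now `uw` is a `y`-edge, while `vw'` is an `x`-edge. The paths `v, w', p` and `u, w, q` use one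
-- edge of each of these directions in opposite orders, so that `vw'` faces the parallel `wq`, and
-- `w'p` faces the parallel `uw`.
theorem exists_closer_of_rung_y (χ : Chart G) (hG : G.Connected) {u w v w' n₀ n₁ n₂ : V}
    (huw : G.Adj u w) (hvw : G.Adj v w') (hu2 : 2 < G.dist u v)
    (hu : G.dist u w' < G.dist u v) (hv : G.dist v w < G.dist v u)
    (hx : (χ.toFun w').x = (χ.toFun v).x + 1)
    (hv0 : (χ.toFun v).z = -(χ.toFun v).x - (χ.toFun v).y)
    (hn0 : (χ.toFun n₀).x = (χ.toFun v).x ∧ (χ.toFun n₀).z = -(χ.toFun v).x - (χ.toFun n₀).y)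
    (hn1 : (χ.toFun n₁).x = (χ.toFun v).x ∧ (χ.toFun n₁).y = (χ.toFun n₀).y ∧
      (χ.toFun n₁).z = (χ.toFun n₀).z + 1)
    (hn2 : (χ.toFun n₂).x = (χ.toFun v).x ∧ (χ.toFun n₂).y = (χ.toFun n₀).y - 1 ∧
      (χ.toFun n₂).z = (χ.toFun n₀).z + 1)
    (h12 : G.Adj n₂ n₁) (hle : (χ.toFun n₀).y ≤ (χ.toFun v).y)
    (hfull : ∀ q, (χ.toFun n₀).y - 1 ≤ q → q < (χ.toFun v).y → χ.FullAt (χ.toFun v).x q)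
    (hPn1 : G.dist n₁ w < G.dist n₁ u) (hPn2 : G.dist n₂ u < G.dist n₂ w) :
    ∃ a b, G.dist a u < G.dist u v ∧ G.dist a v < G.dist u v ∧
      ∀ s, G.dist s a + G.dist s b ≤ G.dist s u + G.dist s v := by
  set a := (χ.toFun v).x with ha
  set b := (χ.toFun v).y with hb
  set β := (χ.toFun n₂).y with hβ
  have hcr := χ.dist_lt_of_crossing hG huw h12 hPn2 hPn1
  obtain ⟨hy, hyfull⟩ := ((χ.comp .rot).cut_x hG h12
    (show (χ.toFun n₁).y = (χ.toFun n₂).y + 1 by omega)).2 u w huw hcr.1 hcr.2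
  change (χ.toFun u).y = (χ.toFun n₂).y ∧ (χ.toFun w).y = (χ.toFun n₂).y + 1 ∧
    (χ.toFun w).z = (χ.toFun u).z ∧ (χ.toFun w).x = (χ.toFun u).x at hy
  change ∀ q, ((χ.toFun n₂).z ≤ q ∧ q < (χ.toFun u).z) ∨
    ((χ.toFun u).z ≤ q ∧ q < (χ.toFun n₂).z) → (χ.comp .rot).FullAt (χ.toFun n₂).y q at hyfull
  rw [← hβ] at hy hyfull
  have su := (χ.toFun u).sum_eq
  have sw := (χ.toFun w).sum_eq
  have sv := (χ.toFun w').sum_eq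
  have hw' : (χ.toFun w').y = b ∧ (χ.toFun w').z = -a - b := by
    have hadj := (hexGrid_adj_iff _ _).1 (χ.adj v w' hvw)
    rcases hadj with h | h | h | h | h | h <;> omega
  have su' : (χ.toFun u).x + (χ.toFun u).y + (χ.toFun u).z = 0 := by omega
  clear su sw sv
  clear hcr hPn1 hPn2
  -- paths along the two strips
  have hdown : ∀ {B : HexVertex → Prop} {p : V}, (χ.toFun p).x = a →
      (χ.toFun p).z = -a - (χ.toFun p).y → β ≤ (χ.toFun p).y → (χ.toFun p).y ≤ b →
      (∀ P : HexVertex, P.x = a → P.y ≤ (χ.toFun p).y → B P) → χ.Joined B n₂ p := by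
    intro B p h1 h2 h3 h4 hB
    exact (χ.strip hG (a := a) (e := 0) (B := B) (p := n₂) (p' := p) (Or.inl rfl)
        (by omega) (fun q h1 h2 => hfull q (by omega) (by omega)) (by omega) (by omega)
        (by omega) (by omega) (fun P h1 _ h3 _ _ => hB P (by omega) h3)).1
  have hside : ∀ {B : HexVertex → Prop}, (∀ P : HexVertex, P.y = β →
      ((χ.toFun u).x ≤ a → P.x ≤ a) → B P) → χ.Joined B n₂ u := by
    intro B hB
    change (χ.comp .rot).Joined (fun P => B ⟨P.z, P.x, P.y, by have := P.sum_eq; omega⟩) n₂ u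
    rcases le_total (χ.toFun n₂).z (χ.toFun u).z with h | h
    · exact ((χ.comp .rot).strip hG (a := β) (e := 0) (p := n₂) (p' := u) (Or.inl rfl) h
        (fun q h1 h2 => hyfull q (Or.inl ⟨h1, h2⟩))
        (show (χ.toFun n₂).y = β + 0 by omega)
        (show (χ.toFun n₂).x = -β - (χ.toFun n₂).z by omega)
        (show (χ.toFun u).y = β + 0 by omega)
        (show (χ.toFun u).x = -β - (χ.toFun u).z by omega)
        (fun P h1 _ _ _ h5 => hB _ (show P.x = β by omega) (fun _ => by
          change P.z ≤ (χ.toFun n₂).x at h5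
          change P.z ≤ a
          omega))).1
    · exact ((χ.comp .rot).strip hG (a := β) (e := 0) (p := u) (p' := n₂) (Or.inl rfl) h
        (fun q h1 h2 => hyfull q (Or.inr ⟨h1, h2⟩))
        (show (χ.toFun u).y = β + 0 by omega)
        (show (χ.toFun u).x = -β - (χ.toFun u).z by omega)
        (show (χ.toFun n₂).y = β + 0 by omega)
        (show (χ.toFun n₂).x = -β - (χ.toFun n₂).z by omega)
        (fun P h1 _ _ _ h5 => hB _ (show P.x = β by omega) (fun _ => by
          change P.z ≤ (χ.toFun u).x at h5
          change P.z ≤ a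
          omega))).1.symm
  -- `u` lies on the far side of the strip
  have hux : a + 1 ≤ (χ.toFun u).x := by
    by_contra hcon
    have hJ : χ.Joined (fun P => P.x ≤ a) v u :=
      (hdown (p := v) rfl hv0 (by omega) le_rfl (fun P h _ => by omega)).symm.trans
        (hside (fun P _ h => h (by omega)))
    exact (χ.dist_lt_of_joined_x hG hvw (by omega) hJ (fun P h => by omega)).not_gt hu
  -- the first replacement vertex
  have hFv := hfull (b - 1) (by omega) (by omega)
  obtain ⟨p₀, p, hp₀, hp, hwp⟩ := hFv.exists_adj (x := a + 1) (y := b) (z := -a - b)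
    (x' := a + 1) (y' := b - 1) (z' := -a - b) (by omega) (by omega) (by omega) (by omega)
    (by omega)
  obtain rfl : w' = p₀ := χ.eq_of_coord (by simp [hp₀, hx]) (by simp [hp₀, hw'])
    (by simp [hp₀, hw'])
  obtain ⟨p₀, p₁, hp₀, hp₁, hpp⟩ := hFv.exists_adj (x := a + 1) (y := b - 1) (z := -a - b)
    (x' := a + 1) (y' := b - 1) (z' := -a - b + 1) (by omega) (by omega) (by omega) (by omega)
    (by omega)
  obtain rfl : p = p₀ := χ.inj (hp.trans hp₀.symm)
  obtain ⟨p₀, p₂, hp₀, hp₂, hpp'⟩ := hFv.exists_adj (x := a + 1) (y := b - 1) (z := -a - b + 1)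
    (x' := a) (y' := b - 1) (z' := -a - b + 1) (by omega) (by omega) (by omega) (by omega)
    (by omega)
  obtain rfl : p₁ = p₀ := χ.inj (hp₁.trans hp₀.symm)
  have cp : (χ.toFun p).x = a + 1 ∧ (χ.toFun p).y = b - 1 := by simp [hp]
  have cp₁ : (χ.toFun p₁).x = a + 1 ∧ (χ.toFun p₁).y = b - 1 := by simp [hp₁]
  have cp₂ : (χ.toFun p₂).x = a ∧ (χ.toFun p₂).y = b - 1 ∧ (χ.toFun p₂).z = -a - b + 1 := by
    simp [hp₂]
  clear hp hp₁ hp₂ hp₀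
  -- the second replacement vertex
  have hFu := hyfull (χ.toFun u).z (by omega)
  obtain ⟨q₀, q, hq₀, hq, hwq⟩ := hFu.exists_adj (x := β + 1) (y := (χ.toFun u).z)
    (z := (χ.toFun u).x) (x' := β + 1) (y' := (χ.toFun u).z) (z' := (χ.toFun u).x - 1)
    (by omega) (by omega) (by omega) (by omega) (by omega)
  have cq₀ : (χ.toFun q₀).y = β + 1 ∧ (χ.toFun q₀).z = (χ.toFun u).z ∧
      (χ.toFun q₀).x = (χ.toFun u).x := HexVertex.ext_iff.1 hq₀
  have cq : (χ.toFun q).y = β + 1 ∧ (χ.toFun q).z = (χ.toFun u).z ∧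
      (χ.toFun q).x = (χ.toFun u).x - 1 := HexVertex.ext_iff.1 hq
  obtain rfl : w = q₀ := χ.eq_of_coord (by omega) (by omega) (by omega)
  obtain ⟨q₀, q₁, hq₀, hq₁, hqq⟩ := hFu.exists_adj (x := β + 1) (y := (χ.toFun u).z)
    (z := (χ.toFun u).x - 1) (x' := β + 1) (y' := (χ.toFun u).z + 1) (z' := (χ.toFun u).x - 1)
    (by omega) (by omega) (by omega) (by omega) (by omega)
  obtain rfl : q = q₀ := (χ.comp .rot).inj (hq.trans hq₀.symm)
  have cq₁ : (χ.toFun q₁).y = β + 1 ∧ (χ.toFun q₁).z = (χ.toFun u).z + 1 ∧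
      (χ.toFun q₁).x = (χ.toFun u).x - 1 := HexVertex.ext_iff.1 hq₁
  clear hq hq₁ hq₀
  -- the facing pairs of parallel edges are `vw'`, `wq` and `w'p`, `uw`
  have hA : G.dist w w' < G.dist w v := by
    -- Otherwise `wu` would cross the cut of `vw'` and thus change `x`; but it is a `y`-edge.
    refine (χ.dist_lt_or_lt hG hvw w).resolve_left fun h => ?_
    have := χ.cut_x_coord hG hvw (by omega) huw.symm h hu
    omega
  have hB : G.dist w' w < G.dist w' u := by
    refine (χ.dist_lt_or_lt hG huw w').resolve_left fun h => ?_
    have := χ.cut_y_coord hG huw (by omega) hvw.symm h hv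
    omega
  have hC : G.dist v q < G.dist v w := by
    clear hA hB hu hv hu2 hw'
    -- The path from `q` along the strip of `uw` to `n₁`, then to `n₂` and up to `v`, avoids the
    -- `x`-level of `w`. That `n₂` and the side up to `v` stay below this level is `hux`.
    let B : HexVertex → Prop := fun P => P.x ≤ (χ.toFun u).x - 1
    have j1 : χ.Joined B q₁ n₁ :=
      ((χ.comp .rot).strip hG (a := β) (e := 1) (p := q₁) (p' := n₁)
        (B := fun P => P.z ≤ (χ.toFun u).x - 1) (Or.inr rfl)
        (show (χ.toFun q₁).z ≤ (χ.toFun n₁).z by omega)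
        (fun q h1 h2 => hyfull q (Or.inr (by
          change (χ.toFun q₁).z ≤ q at h1
          change q < (χ.toFun n₁).z at h2
          omega)))
        (show (χ.toFun q₁).y = β + 1 by omega)
        (show (χ.toFun q₁).x = -β - (χ.toFun q₁).z by omega)
        (show (χ.toFun n₁).y = β + 1 by omega)
        (show (χ.toFun n₁).x = -β - (χ.toFun n₁).z by omega)
        (fun P h1 _ _ _ h5 => by
          change P.z ≤ (χ.toFun q₁).x at h5
          omega)).1
    have j2 : χ.Joined B n₂ v := hdown (p := v) rfl hv0 (by omega) le_rfl
      (fun P h _ => by simp only [B]; omega)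
    have hJ : χ.Joined B q v := by
      refine (Joined.of_adj hqq ?_ ?_).trans (j1.trans ((Joined.of_adj h12.symm ?_ ?_).trans j2))
        <;> simp only [B] <;> omega
    exact χ.dist_lt_of_joined_x hG hwq.symm (by omega) hJ (fun P h => by simp only [B] at h; omega)
  have hD : G.dist u p < G.dist u w' := by
    clear hA hB hC hu hv hu2 hx cq cq₁ cq₀
    -- The path from `p` through `p₁`, `p₂`, down to `n₂` and along the strip to `u` avoids the
    -- `y`-level of `w'`.
    let B : HexVertex → Prop := fun P => P.y ≤ b - 1
    have j1 : χ.Joined B n₂ p₂ := hdown (p := p₂) cp₂.1 (by omega) (by omega) (by omega)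
      (fun P _ h => by simp only [B]; omega)
    have j2 : χ.Joined B n₂ u := hside (fun P h _ => by simp only [B]; omega)
    have hJ : χ.Joined B p u := by
      refine (Joined.of_adj hpp ?_ ?_).trans ((Joined.of_adj hpp' ?_ ?_).trans
        (j1.symm.trans j2)) <;> simp only [B] <;> omega
    exact χ.dist_lt_of_joined_y hG hwp.symm (by omega) hJ (fun P h => by simp only [B] at h; omega)
  refine ⟨p, q, ?_, ?_, fun s => ?_⟩
  · rw [SimpleGraph.dist_comm]
    omega
  -- `d(p,v) ≤ 2`: the hypothesis `2 < d(u,v)` is needed in full here.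
  · have h1 := hG.dist_triangle (u := p) (v := w') (w := v)
    have h2 := SimpleGraph.dist_eq_one_iff_adj.2 hwp.symm
    have h3 := SimpleGraph.dist_eq_one_iff_adj.2 hvw.symm
    omega
  -- In the sum of the two inequalities the terms for `w` and `w'` cancel.
  · have h1 := χ.dist_add_dist_le_of_parallel_x hG hwq hvw hA hC (by omega) (by omega) s
    have h2 := χ.dist_add_dist_le_of_parallel_y hG huw hwp hD hB (by omega) (by omega) s
    omega

/-- Along the side of the strip from `t` to `v` the halfspace of `uw` changes within one hexagon,
between `n₂` and `n₀`. The vertex `n₁` between them decides whether the change occurs on a `z`-edge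
or on a `y`-edge. -/
theorem exists_closer_of_descent (χ : Chart G) (hG : G.Connected) {u w v w' t : V}
    (huw : G.Adj u w) (hvw : G.Adj v w') (hu2 : 2 < G.dist u v)
    (hu : G.dist u w' < G.dist u v) (hv : G.dist v w < G.dist v u)
    (hx : (χ.toFun w').x = (χ.toFun v).x + 1)
    (htu : G.dist t u < G.dist t w) (htx : (χ.toFun t).x = (χ.toFun v).x)
    (ht0 : (χ.toFun t).z = -(χ.toFun v).x - (χ.toFun t).y)
    (hle : (χ.toFun t).y ≤ (χ.toFun v).y)
    (hfull : ∀ q, (χ.toFun t).y ≤ q → q < (χ.toFun v).y → χ.FullAt (χ.toFun v).x q) :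
    ∃ a b, G.dist a u < G.dist u v ∧ G.dist a v < G.dist u v ∧
      ∀ s, G.dist s a + G.dist s b ≤ G.dist s u + G.dist s v := by
  have s1 := (χ.toFun v).sum_eq
  have s2 := (χ.toFun w').sum_eq
  have hv0 : (χ.toFun v).z = -(χ.toFun v).x - (χ.toFun v).y := by
    have hadj := (hexGrid_adj_iff _ _).1 (χ.adj v w' hvw)
    rcases hadj with h | h | h | h | h | h <;> omega
  obtain ⟨n, hn⟩ := Int.le.dest hle
  obtain ⟨n₀, n₂, h0, h2, hn0, hn2, hy, hy0, hy2⟩ := χ.exists_rung (a := (χ.toFun v).x) (v := v)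
    (P := fun x => G.dist x w < G.dist x u) ⟨rfl, hv0⟩ hv n ⟨htx, ht0⟩ hn.symm (by omega) hfull
  have hF := hfull (χ.toFun n₂).y hy2 (by omega)
  obtain ⟨m₀, n₁, hm₀, hn₁, h01⟩ := hF.exists_adj (x := (χ.toFun v).x) (y := (χ.toFun n₂).y + 1)
    (z := -(χ.toFun v).x - ((χ.toFun n₂).y + 1)) (x' := (χ.toFun v).x)
    (y' := (χ.toFun n₂).y + 1) (z' := -(χ.toFun v).x - (χ.toFun n₂).y)
    (by omega) (by omega) (by omega) (by omega) (by omega)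
  obtain ⟨m₂, m₁, hm₂, hm₁, h12⟩ := hF.exists_adj (x := (χ.toFun v).x) (y := (χ.toFun n₂).y)
    (z := -(χ.toFun v).x - (χ.toFun n₂).y) (x' := (χ.toFun v).x)
    (y' := (χ.toFun n₂).y + 1) (z' := -(χ.toFun v).x - (χ.toFun n₂).y)
    (by omega) (by omega) (by omega) (by omega) (by omega)
  obtain rfl : n₁ = m₁ := χ.inj (hn₁.trans hm₁.symm)
  obtain rfl : n₀ = m₀ := χ.eq_of_coord (by simp [hm₀, hn0]) (by simp [hm₀, hy])
    (by simp [hm₀, hn0, hy])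
  obtain rfl : n₂ = m₂ := χ.eq_of_coord (by simp [hm₂, hn2]) (by simp [hm₂])
    (by simp [hm₂, hn2])
  have cn₁ : (χ.toFun n₁).x = (χ.toFun v).x ∧ (χ.toFun n₁).y = (χ.toFun n₂).y + 1 ∧
      (χ.toFun n₁).z = -(χ.toFun v).x - (χ.toFun n₂).y := by simp [hn₁]
  rcases χ.dist_lt_or_lt hG huw n₁ with h | h
  · exact χ.exists_closer_of_rung_z hG huw (by omega) hv hv0 hn0 (by omega) h01 hy0
      (fun q h1 h2 => hfull q (by omega) h2) h0 h
  · exact χ.exists_closer_of_rung_y hG huw hvw hu2 hu hv hx hv0 hn0 (by omega) (by omega) h12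
      hy0 (fun q h1 h2 => hfull q (by omega) h2) h ((χ.dist_lt_or_lt hG huw n₂).resolve_right h2)

/-- Either the pair `w', w` works, or the strip of `vw'` contains a vertex `t` behind `uw`. If `t`
is above `v`, exchanging `y` and `z` puts it below. -/
theorem exists_closer_of_lower (χ : Chart G) (hG : G.Connected) {u w v w' : V}
    (huw : G.Adj u w) (hvw : G.Adj v w') (hu2 : 2 < G.dist u v)
    (hu : G.dist u w' < G.dist u v) (hv : G.dist v w < G.dist v u)
    (hx : (χ.toFun w').x = (χ.toFun v).x + 1) :
    ∃ a b, G.dist a u < G.dist u v ∧ G.dist a v < G.dist u v ∧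
      ∀ s, G.dist s a + G.dist s b ≤ G.dist s u + G.dist s v := by
  by_cases hall : ∀ s, G.dist s w' + G.dist s w ≤ G.dist s v + G.dist s u
  · refine ⟨w', w, by rwa [SimpleGraph.dist_comm], ?_, fun s => ?_⟩
    · rw [SimpleGraph.dist_eq_one_iff_adj.2 hvw.symm]
      omega
    · rw [add_comm (G.dist s u)]
      exact hall s
  push Not at hall
  obtain ⟨s, hs⟩ := hall
  obtain ⟨t, t', htt, htu, htv, htw⟩ := χ.exists_crossing hG huw hvw hu (not_le.2 hs)
  have s1 := (χ.toFun t).sum_eq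
  have s2 := (χ.toFun t').sum_eq
  rcases le_total (χ.toFun t).y (χ.toFun v).y with h | h
  · obtain ⟨hc, hfull⟩ := (χ.cut_x hG hvw hx).2 t t' htt htv htw
    exact χ.exists_closer_of_descent hG huw hvw hu2 hu hv hx htu hc.1 (by omega) h
      (fun q h1 h2 => hfull q (Or.inr ⟨h1, h2⟩))
  · obtain ⟨hc, hfull⟩ := ((χ.comp .swap).cut_x hG hvw hx).2 t t' htt htv htw
    change (χ.toFun t).x = (χ.toFun v).x ∧ (χ.toFun t').x = (χ.toFun v).x + 1 ∧
      (χ.toFun t').z = (χ.toFun t).z ∧ (χ.toFun t').y = (χ.toFun t).y at hc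
    have s3 := (χ.toFun v).sum_eq
    have s4 := (χ.toFun w').sum_eq
    have hadj := (hexGrid_adj_iff _ _).1 (χ.adj v w' hvw)
    have hv0 : (χ.toFun v).z = -(χ.toFun v).x - (χ.toFun v).y := by
      rcases hadj with h | h | h | h | h | h <;> omega
    exact (χ.comp .swap).exists_closer_of_descent hG huw hvw hu2 hu hv hx htu hc.1
      (show (χ.toFun t).y = -(χ.toFun v).x - (χ.toFun t).z by omega)
      (show (χ.toFun t).z ≤ (χ.toFun v).z by omega)
      (fun q h1 h2 => hfull q (Or.inr ⟨h1, h2⟩))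

theorem exists_closer_of_x (χ : Chart G) (hG : G.Connected) {u w v w' : V}
    (huw : G.Adj u w) (hvw : G.Adj v w') (hu2 : 2 < G.dist u v)
    (hu : G.dist u w' < G.dist u v) (hv : G.dist v w < G.dist v u)
    (hx : (χ.toFun v).x ≠ (χ.toFun w').x) :
    ∃ a b, G.dist a u < G.dist u v ∧ G.dist a v < G.dist u v ∧
      ∀ s, G.dist s a + G.dist s b ≤ G.dist s u + G.dist s v := by
  have hadj := (hexGrid_adj_iff _ _).1 (χ.adj v w' hvw)
  have h : (χ.toFun w').x = (χ.toFun v).x + 1 ∨ -(χ.toFun w').x = -(χ.toFun v).x + 1 := by omega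
  rcases h with h | h
  · exact χ.exists_closer_of_lower hG huw hvw hu2 hu hv h
  · exact (χ.comp .inv).exists_closer_of_lower hG huw hvw hu2 hu hv h

theorem hasPowerConnectedMedians [Finite V] (χ : Chart G) (hG : G.Connected) :
    HasPowerConnectedMedians G 2 := by
  refine hasPowerConnectedMedians_of_exists_closer hG 2 fun u v huv => ?_
  have step : ∀ {x y : V}, 2 < G.dist x y → ∃ z, G.Adj x z ∧ G.dist y z < G.dist y x := by
    intro x y hxy
    obtain ⟨s, z, hsz, hs, -, hd⟩ := exists_adj_of_geodesic hG (P := fun z => z = x) (a := x)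
      (b := y) rfl (fun h => by simp [h] at hxy)
    subst hs
    refine ⟨z, hsz, ?_⟩
    rw [SimpleGraph.dist_comm, SimpleGraph.dist_comm (u := y) (v := s), hd]
    omega
  obtain ⟨w, huw, hv⟩ := step huv
  obtain ⟨w', hvw, hu⟩ := step (x := v) (y := u) (by rwa [SimpleGraph.dist_comm])
  rcases χ.exists_ne_coord hvw with h | h | h
  · exact χ.exists_closer_of_x hG huw hvw huv hu hv h
  · exact (χ.comp .rot).exists_closer_of_x hG huw hvw huv hu hv h
  · exact ((χ.comp .rot).comp .rot).exists_closer_of_x hG huw hvw huv hu hv h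

end Chart

/-! ### The tessellation of the plane by hexagons -/

/-- The linear function with value `y - z` at the position of the vertex `(x, y, z)`. -/
noncomputable def coordB : ℂ →L[ℝ] ℝ := (2 / Real.sqrt 3) • Complex.imCLM

/-- The linear function with value `x - y` at the position of the vertex `(x, y, z)`. -/
noncomputable def coordA : ℂ →L[ℝ] ℝ := Complex.reCLM - (1 / 2 : ℝ) • coordB

theorem coordB_mk (r s : ℝ) : coordB ⟨r, Real.sqrt 3 / 2 * s⟩ = s := by
  have : Real.sqrt 3 ≠ 0 := by positivity
  simp [coordB]
  field_simp

theorem coordA_mk (r s : ℝ) : coordA ⟨r, Real.sqrt 3 / 2 * s⟩ = r - s / 2 := by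
  simp only [coordA, sub_apply, smul_apply, coordB_mk,
    Complex.reCLM_apply, smul_eq_mul]
  ring

theorem coordA_pos (v : HexVertex) : coordA v.pos = v.x - v.y := by
  rw [HexVertex.pos, coordA_mk]
  ring

theorem coordB_pos (v : HexVertex) : coordB v.pos = v.y - v.z := by
  rw [HexVertex.pos, coordB_mk]

theorem eq_of_coords {p q : ℂ} (hA : coordA p = coordA q) (hB : coordB p = coordB q) : p = q := by
  have h3 : 2 / Real.sqrt 3 ≠ 0 := by positivity
  simp only [coordA, sub_apply, smul_apply, hB,
    sub_left_inj, Complex.reCLM_apply] at hA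
  simp only [coordB, smul_apply, smul_eq_mul, Complex.imCLM_apply] at hB
  exact Complex.ext hA (mul_left_cancel₀ h3 hB)

theorem pos_injective : Function.Injective HexVertex.pos := by
  intro v w h
  have hA := congrArg coordA h
  have hB := congrArg coordB h
  rw [coordA_pos, coordA_pos] at hA
  rw [coordB_pos, coordB_pos] at hB
  have hA' : v.x - v.y = w.x - w.y := by exact_mod_cast hA
  have hB' : v.y - v.z = w.y - w.z := by exact_mod_cast hB
  have h1 := v.sum_eq
  have h2 := w.sum_eq
  ext <;> omega

theorem mem_segment_iff {p a b : ℂ} : p ∈ segment ℝ a b ↔ ∃ t : ℝ, 0 ≤ t ∧ t ≤ 1 ∧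
    coordA p = (1 - t) * coordA a + t * coordA b ∧
    coordB p = (1 - t) * coordB a + t * coordB b := by
  rw [segment_eq_image]
  constructor
  · rintro ⟨t, ht, rfl⟩
    exact ⟨t, ht.1, ht.2, by simp only [map_add, map_smul, smul_eq_mul],
      by simp only [map_add, map_smul, smul_eq_mul]⟩
  · rintro ⟨t, h0, h1, hA, hB⟩
    exact ⟨t, ⟨h0, h1⟩, eq_of_coords
      (by simp only [map_add, map_smul, smul_eq_mul, hA])
      (by simp only [map_add, map_smul, smul_eq_mul, hB])⟩

/-- The closed hexagon `h`. -/
def tile (h : HexCell) : Set ℂ :=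
  {p | |coordA p - (h.a - h.b)| ≤ 1 ∧ |coordB p - (h.b - h.c)| ≤ 1 ∧
    |coordA p + coordB p - (h.a - h.c)| ≤ 1}

/-- The interior of the hexagon `h`. -/
def openTile (h : HexCell) : Set ℂ :=
  {p | |coordA p - (h.a - h.b)| < 1 ∧ |coordB p - (h.b - h.c)| < 1 ∧
    |coordA p + coordB p - (h.a - h.c)| < 1}

/-- The center of the hexagon `h`. -/
noncomputable def HexCell.center (h : HexCell) : ℂ :=
  ⟨(h.a : ℝ) - ((h.b : ℝ) + (h.c : ℝ)) / 2, Real.sqrt 3 / 2 * ((h.b : ℝ) - (h.c : ℝ))⟩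

theorem coordA_center (h : HexCell) : coordA h.center = h.a - h.b := by
  rw [HexCell.center, coordA_mk]
  ring

theorem coordB_center (h : HexCell) : coordB h.center = h.b - h.c := by
  rw [HexCell.center, coordB_mk]

theorem center_mem_openTile (h : HexCell) : h.center ∈ openTile h := by
  simp [openTile, coordA_center, coordB_center]

theorem convex_tile (h : HexCell) : Convex ℝ (tile h) := by
  intro p hp q hq s t hs ht hst
  simp only [tile, Set.mem_ofPred_eq, map_add, map_smul, smul_eq_mul, abs_le] at *
  obtain rfl : s = 1 - t := by linarith
  refine ⟨⟨?_, ?_⟩, ⟨?_, ?_⟩, ⟨?_, ?_⟩⟩ <;> nlinarith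

theorem convex_openTile (h : HexCell) : Convex ℝ (openTile h) := by
  have hl : ∀ (f : ℂ →L[ℝ] ℝ) (c : ℝ), Convex ℝ {p | |f p - c| < 1} := by
    intro f c
    have : {p | |f p - c| < 1} = f ⁻¹' Metric.ball c 1 := by
      ext p
      simp [Real.dist_eq]
    rw [this]
    exact (convex_ball c 1).is_linear_preimage f.toLinearMap.isLinear
  exact (hl coordA _).inter ((hl coordB _).inter (hl (coordA + coordB) _))

theorem tile_subset_closure (h : HexCell) : tile h ⊆ closure (openTile h) := by
  intro p hp
  -- Points strictly between the center and a point of the closed hexagon are interior.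
  have hsub : openSegment ℝ h.center p ⊆ openTile h := by
    rintro q ⟨s, t, hs, ht, hst, rfl⟩
    obtain rfl : s = 1 - t := by linarith
    simp only [tile, openTile, Set.mem_ofPred_eq, map_add, map_smul, smul_eq_mul, abs_le, abs_lt,
      coordA_center, coordB_center] at *
    refine ⟨⟨?_, ?_⟩, ⟨?_, ?_⟩, ⟨?_, ?_⟩⟩ <;> nlinarith
  refine closure_mono hsub ?_
  rw [closure_openSegment]
  exact right_mem_segment ℝ _ _

theorem isClosed_tile (h : HexCell) : IsClosed (tile h) := by
  have hl : ∀ (f : ℂ →L[ℝ] ℝ) (c : ℝ), IsClosed {p | |f p - c| ≤ 1} := fun f c =>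
    isClosed_le (by fun_prop) (by fun_prop)
  exact (hl coordA _).inter ((hl coordB _).inter (hl (coordA + coordB) _))

theorem pos_mem_tile {v : HexVertex} {h : HexCell} (hv : Incident v h) : v.pos ∈ tile h := by
  simp only [tile, Set.mem_ofPred_eq, coordA_pos, coordB_pos, abs_le]
  obtain ⟨⟨h1, h2⟩, ⟨h3, h4⟩, ⟨h5, h6⟩⟩ := hv
  have h1' : (h.a : ℝ) ≤ v.x := by exact_mod_cast h1
  have h2' : (v.x : ℝ) ≤ h.a + 1 := by exact_mod_cast h2
  have h3' : (h.b : ℝ) ≤ v.y := by exact_mod_cast h3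
  have h4' : (v.y : ℝ) ≤ h.b + 1 := by exact_mod_cast h4
  have h5' : (h.c : ℝ) ≤ v.z := by exact_mod_cast h5
  have h6' : (v.z : ℝ) ≤ h.c + 1 := by exact_mod_cast h6
  refine ⟨⟨?_, ?_⟩, ⟨?_, ?_⟩, ⟨?_, ?_⟩⟩ <;> linarith

theorem finite_cells (r s r' s' : ℤ) :
    {h : HexCell | (r ≤ h.a - h.b ∧ h.a - h.b ≤ s) ∧ (r' ≤ h.b - h.c ∧ h.b - h.c ≤ s')}.Finite := by
  have hinj : Function.Injective (fun h : HexCell => (h.a - h.b, h.b - h.c)) := by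
    intro h k hk
    simp only [Prod.mk.injEq] at hk
    have h1 := h.sum_eq
    have h2 := k.sum_eq
    ext <;> omega
  refine (((Set.finite_Icc r s).prod (Set.finite_Icc r' s')).preimage hinj.injOn).subset ?_
  rintro h ⟨h1, h2⟩
  exact ⟨h1, h2⟩

theorem locallyFinite_tile : LocallyFinite tile := by
  intro p
  refine ⟨{q | |coordA q - coordA p| < 1} ∩ {q | |coordB q - coordB p| < 1}, ?_, ?_⟩
  · refine IsOpen.mem_nhds (IsOpen.inter ?_ ?_) (by simp)
    · exact isOpen_lt (by fun_prop) (by fun_prop)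
    · exact isOpen_lt (by fun_prop) (by fun_prop)
  · refine (finite_cells (⌊coordA p⌋ - 2) (⌊coordA p⌋ + 3) (⌊coordB p⌋ - 2)
      (⌊coordB p⌋ + 3)).subset ?_
    rintro h ⟨q, ⟨hq1, hq2, -⟩, hq3, hq4⟩
    simp only [Set.mem_ofPred_eq, abs_le, abs_lt] at *
    have f1 := Int.floor_le (coordA p)
    have f2 := Int.lt_floor_add_one (coordA p)
    have f3 := Int.floor_le (coordB p)
    have f4 := Int.lt_floor_add_one (coordB p)
    have g1 : (⌊coordA p⌋ : ℝ) - 2 < (h.a - h.b : ℤ) + 1 := by push_cast; linarith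
    have g2 : ((h.a - h.b : ℤ) : ℝ) < ⌊coordA p⌋ + 3 := by push_cast; linarith
    have g3 : (⌊coordB p⌋ : ℝ) - 2 < (h.b - h.c : ℤ) + 1 := by push_cast; linarith
    have g4 : ((h.b - h.c : ℤ) : ℝ) < ⌊coordB p⌋ + 3 := by push_cast; linarith
    have g1' : ⌊coordA p⌋ - 2 < (h.a - h.b) + 1 := by exact_mod_cast g1
    have g2' : (h.a - h.b) < ⌊coordA p⌋ + 3 := by exact_mod_cast g2
    have g3' : ⌊coordB p⌋ - 2 < (h.b - h.c) + 1 := by exact_mod_cast g3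
    have g4' : (h.b - h.c) < ⌊coordB p⌋ + 3 := by exact_mod_cast g4
    omega

/-- The hexagons cover the plane. -/
theorem exists_mem_tile (p : ℂ) : ∃ h, p ∈ tile h := by
  -- A center has `coordB - coordA = 3b + 1`, because `a + b + c = -1`; so the centers are the
  -- integer points in this residue class. Every unit square has one or two corners in it, and the
  -- diagonal decides between two.
  have key : ∀ α β : ℤ, (β - α) % 3 = 1 → |coordA p - α| ≤ 1 → |coordB p - β| ≤ 1 →
      |coordA p + coordB p - (α + β)| ≤ 1 → ∃ h, p ∈ tile h := by
    intro α β hm h1 h2 h3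
    have hb : 3 * ((β - α) / 3) = β - α - 1 := by omega
    generalize (β - α) / 3 = b at hb
    refine ⟨⟨b + α, b, b - β, by omega⟩, ?_, ?_, ?_⟩
    · push_cast
      convert h1 using 3; ring
    · push_cast
      convert h2 using 3; ring
    · push_cast
      convert h3 using 3; ring
  have f1 := Int.floor_le (coordA p)
  have f2 := Int.lt_floor_add_one (coordA p)
  have f3 := Int.floor_le (coordB p)
  have f4 := Int.lt_floor_add_one (coordB p)
  have hr : (⌊coordB p⌋ - ⌊coordA p⌋) % 3 = 0 ∨ (⌊coordB p⌋ - ⌊coordA p⌋) % 3 = 1 ∨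
      (⌊coordB p⌋ - ⌊coordA p⌋) % 3 = 2 := by omega
  rcases hr with hr | hr | hr
  · refine key ⌊coordA p⌋ (⌊coordB p⌋ + 1) (by omega) ?_ ?_ ?_ <;> rw [abs_le] <;> push_cast <;>
      constructor <;> linarith
  · rcases le_total (coordA p + coordB p) (⌊coordA p⌋ + ⌊coordB p⌋ + 1) with h | h
    · refine key ⌊coordA p⌋ ⌊coordB p⌋ (by omega) ?_ ?_ ?_ <;> rw [abs_le] <;>
        constructor <;> linarith
    · refine key (⌊coordA p⌋ + 1) (⌊coordB p⌋ + 1) (by omega) ?_ ?_ ?_ <;> rw [abs_le] <;>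
        push_cast <;> constructor <;> linarith
  · refine key (⌊coordA p⌋ + 1) ⌊coordB p⌋ (by omega) ?_ ?_ ?_ <;> rw [abs_le] <;> push_cast <;>
      constructor <;> linarith

theorem exists_common_edge_aux {p : ℂ} {h k : HexCell} (hp : p ∈ tile h) (hk : p ∈ tile k)
    (hc : (k.a = h.a + 1 ∧ k.b = h.b - 1 ∧ k.c = h.c) ∨
      (k.a = h.a ∧ k.b = h.b + 1 ∧ k.c = h.c - 1) ∨
      (k.a = h.a - 1 ∧ k.b = h.b ∧ k.c = h.c + 1)) :
    ∃ P Q, hexGrid.Adj P Q ∧ Incident P h ∧ Incident Q h ∧ Incident P k ∧ Incident Q k ∧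
      p ∈ segment ℝ P.pos Q.pos := by
  have hs := h.sum_eq
  simp only [tile, Set.mem_ofPred_eq, abs_le] at hp hk
  rcases hc with ⟨ha, hb, hc⟩ | ⟨ha, hb, hc⟩ | ⟨ha, hb, hc⟩
  · refine ⟨⟨h.a + 1, h.b, h.c, by omega⟩, ⟨h.a + 1, h.b, h.c + 1, by omega⟩, ?_, ?_, ?_, ?_, ?_,
      mem_segment_iff.2 ⟨h.b - h.c - coordB p, ?_⟩⟩
    · rw [hexGrid_adj_iff]; simp
    · simp only [Incident]; omega
    · simp only [Incident]; omega
    · simp only [Incident]; omega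
    · simp only [Incident]; omega
    · simp only [ha, hb, hc] at hk
      push_cast at hk
      simp only [coordA_pos, coordB_pos]
      push_cast
      refine ⟨by linarith, by linarith, ?_, by ring⟩
      ring_nf
      linarith
  · refine ⟨⟨h.a, h.b + 1, h.c, by omega⟩, ⟨h.a + 1, h.b + 1, h.c, by omega⟩, ?_, ?_, ?_, ?_, ?_,
      mem_segment_iff.2 ⟨coordA p - (h.a - h.b - 1), ?_⟩⟩
    · rw [hexGrid_adj_iff]; simp
    · simp only [Incident]; omega
    · simp only [Incident]; omega
    · simp only [Incident]; omega
    · simp only [Incident]; omega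
    · simp only [ha, hb, hc] at hk
      push_cast at hk
      simp only [coordA_pos, coordB_pos]
      push_cast
      refine ⟨by linarith, by linarith, by ring, ?_⟩
      ring_nf
      linarith
  · refine ⟨⟨h.a, h.b, h.c + 1, by omega⟩, ⟨h.a, h.b + 1, h.c + 1, by omega⟩, ?_, ?_, ?_, ?_, ?_,
      mem_segment_iff.2 ⟨h.a - h.b - coordA p, ?_⟩⟩
    · rw [hexGrid_adj_iff]; simp
    · simp only [Incident]; omega
    · simp only [Incident]; omega
    · simp only [Incident]; omega
    · simp only [Incident]; omega
    · simp only [ha, hb, hc] at hk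
      push_cast at hk
      simp only [coordA_pos, coordB_pos]
      push_cast
      refine ⟨by linarith, by linarith, by ring, ?_⟩
      ring_nf
      linarith

/-- Two hexagons intersect at most in a common edge. -/
theorem exists_common_edge {p : ℂ} {h k : HexCell} (hne : h ≠ k) (hp : p ∈ tile h)
    (hk : p ∈ tile k) :
    ∃ P Q, hexGrid.Adj P Q ∧ Incident P h ∧ Incident Q h ∧ Incident P k ∧ Incident Q k ∧
      p ∈ segment ℝ P.pos Q.pos := by
  have hc : ((k.a = h.a + 1 ∧ k.b = h.b - 1 ∧ k.c = h.c) ∨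
      (k.a = h.a ∧ k.b = h.b + 1 ∧ k.c = h.c - 1) ∨
      (k.a = h.a - 1 ∧ k.b = h.b ∧ k.c = h.c + 1)) ∨
      (h.a = k.a + 1 ∧ h.b = k.b - 1 ∧ h.c = k.c) ∨
      (h.a = k.a ∧ h.b = k.b + 1 ∧ h.c = k.c - 1) ∨
      (h.a = k.a - 1 ∧ h.b = k.b ∧ h.c = k.c + 1) := by
    have h1 := h.sum_eq
    have h2 := k.sum_eq
    have h3 : ¬ (h.a = k.a ∧ h.b = k.b ∧ h.c = k.c) := fun e =>
      hne (HexCell.ext e.1 e.2.1 e.2.2)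
    obtain ⟨p1, p2, p3⟩ := hp
    obtain ⟨q1, q2, q3⟩ := hk
    rw [abs_le] at p1 p2 p3 q1 q2 q3
    have e1 : (h.a - h.b : ℝ) ≤ k.a - k.b + 2 := by linarith
    have e2 : (k.a - k.b : ℝ) ≤ h.a - h.b + 2 := by linarith
    have e3 : (h.b - h.c : ℝ) ≤ k.b - k.c + 2 := by linarith
    have e4 : (k.b - k.c : ℝ) ≤ h.b - h.c + 2 := by linarith
    have e5 : (h.a - h.c : ℝ) ≤ k.a - k.c + 2 := by linarith
    have e6 : (k.a - k.c : ℝ) ≤ h.a - h.c + 2 := by linarith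
    norm_cast at e1 e2 e3 e4 e5 e6
    have h4 : k.a = h.a + 1 ∨ k.a = h.a ∨ k.a = h.a - 1 := by omega
    rcases h4 with h4 | h4 | h4 <;> omega
  rcases hc with hc | hc
  · exact exists_common_edge_aux hp hk hc
  · obtain ⟨P, Q, h1, h2, h3, h4, h5, h6⟩ := exists_common_edge_aux hk hp hc
    exact ⟨P, Q, h1, h4, h5, h2, h3, h6⟩

theorem segment_disjoint_openTile_aux {P Q : HexVertex} (h : HexCell)
    (hPQ : (Q.x = P.x + 1 ∧ Q.y = P.y ∧ Q.z = P.z) ∨ (Q.x = P.x ∧ Q.y = P.y + 1 ∧ Q.z = P.z) ∨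
      (Q.x = P.x ∧ Q.y = P.y ∧ Q.z = P.z + 1)) :
    Disjoint (segment ℝ P.pos Q.pos) (openTile h) := by
  rw [Set.disjoint_left]
  rintro p hp ⟨h1, h2, h3⟩
  obtain ⟨t, t0, t1, hA, hB⟩ := mem_segment_iff.1 hp
  have hs := h.sum_eq
  have sP := P.sum_eq
  have sQ := Q.sum_eq
  have sP0 : P.x + P.y + P.z = 0 := by omega
  rw [abs_lt] at h1 h2 h3
  rw [coordA_pos, coordA_pos] at hA
  rw [coordB_pos, coordB_pos] at hB
  -- One of `coordA`, `coordB`, `coordA + coordB` is constant on the edge, with integer offset from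
  -- the center, hence offset 0. The offset of another is then `1 - 3n + t` up to sign, and it would
  -- force `0 < n < 1`.
  have key : ∀ n : ℤ, (-1 : ℝ) < 1 - 3 * n + t → 1 - 3 * n + t < 1 → False := by
    intro n hn1 hn2
    have a1 : (n : ℝ) < 1 := by linarith
    have a2 : (0 : ℝ) < n := by linarith
    norm_cast at a1 a2
    omega
  have int : ∀ n : ℤ, (-1 : ℝ) < n → (n : ℝ) < 1 → n = 0 := by
    intro n hn1 hn2
    have : -1 < n := by exact_mod_cast hn1
    have : n < 1 := by exact_mod_cast hn2
    omega
  rcases hPQ with ⟨hx, hy, hz⟩ | ⟨hx, hy, hz⟩ | ⟨hx, hy, hz⟩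
  · rw [hx, hy] at hA
    rw [hy, hz] at hB
    push_cast at hA
    have := int (P.y - P.z - (h.b - h.c)) (by push_cast; linarith) (by push_cast; linarith)
    have e : (P.x - P.y - (h.a - h.b) : ℤ) = 1 - 3 * (P.y - h.b) := by omega
    have e' : ((P.x - P.y - (h.a - h.b) : ℤ) : ℝ) = ((1 - 3 * (P.y - h.b) : ℤ) : ℝ) := by rw [e]
    push_cast at e'
    exact key (P.y - h.b) (by push_cast; linarith) (by push_cast; linarith)
  · rw [hx, hy] at hA
    rw [hy, hz] at hB
    push_cast at hA hB
    have := int (P.x - P.z - (h.a - h.c)) (by push_cast; linarith) (by push_cast; linarith)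
    have e : (P.y - P.z - (h.b - h.c) : ℤ) = 1 - 3 * (P.z - h.c) := by omega
    have e' : ((P.y - P.z - (h.b - h.c) : ℤ) : ℝ) = ((1 - 3 * (P.z - h.c) : ℤ) : ℝ) := by rw [e]
    push_cast at e'
    exact key (P.z - h.c) (by push_cast; linarith) (by push_cast; linarith)
  · rw [hx, hy] at hA
    rw [hy, hz] at hB
    push_cast at hB
    have := int (P.x - P.y - (h.a - h.b)) (by push_cast; linarith) (by push_cast; linarith)
    have e : (P.z - P.x - (h.c - h.a) : ℤ) = 1 - 3 * (P.x - h.a) := by omega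
    have e' : ((P.z - P.x - (h.c - h.a) : ℤ) : ℝ) = ((1 - 3 * (P.x - h.a) : ℤ) : ℝ) := by rw [e]
    push_cast at e'
    exact key (P.x - h.a) (by push_cast; linarith) (by push_cast; linarith)

/-- Edges of the grid do not meet the interiors of hexagons. -/
theorem segment_disjoint_openTile {P Q : HexVertex} (hPQ : hexGrid.Adj P Q) (h : HexCell) :
    Disjoint (segment ℝ P.pos Q.pos) (openTile h) := by
  rw [hexGrid_adj_iff] at hPQ
  rcases hPQ with h' | h' | h' | h' | h' | h'
  · exact segment_disjoint_openTile_aux h (by omega)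
  · rw [segment_symm]; exact segment_disjoint_openTile_aux h (by omega)
  · exact segment_disjoint_openTile_aux h (by omega)
  · rw [segment_symm]; exact segment_disjoint_openTile_aux h (by omega)
  · exact segment_disjoint_openTile_aux h (by omega)
  · rw [segment_symm]; exact segment_disjoint_openTile_aux h (by omega)

/-- Edges of the grid contain no vertices besides their ends. -/
theorem eq_or_eq_of_pos_mem_segment {v P Q : HexVertex} (hPQ : hexGrid.Adj P Q)
    (hv : v.pos ∈ segment ℝ P.pos Q.pos) : v = P ∨ v = Q := by
  obtain ⟨t, t0, t1, hA, hB⟩ := mem_segment_iff.1 hv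
  -- Along an edge some coordinate changes by `±t`, and it is an integer at both `P` and `v`.
  have hint : ∃ n : ℤ, t = n := by
    rw [coordA_pos, coordA_pos, coordA_pos] at hA
    rw [coordB_pos, coordB_pos, coordB_pos] at hB
    rw [hexGrid_adj_iff] at hPQ
    rcases hPQ with ⟨hx, hy, hz⟩ | ⟨hx, hy, hz⟩ | ⟨hx, hy, hz⟩ | ⟨hx, hy, hz⟩ | ⟨hx, hy, hz⟩ |
      ⟨hx, hy, hz⟩ <;> rw [hx, hy] at hA <;> rw [hy, hz] at hB <;> push_cast at hA hB
    · exact ⟨v.x - v.y - (P.x - P.y), by push_cast; linarith⟩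
    · exact ⟨-(v.x - v.y - (P.x - P.y)), by push_cast; linarith⟩
    · exact ⟨v.y - v.z - (P.y - P.z), by push_cast; linarith⟩
    · exact ⟨-(v.y - v.z - (P.y - P.z)), by push_cast; linarith⟩
    · exact ⟨-(v.y - v.z - (P.y - P.z)), by push_cast; linarith⟩
    · exact ⟨v.y - v.z - (P.y - P.z), by push_cast; linarith⟩
  obtain ⟨n, rfl⟩ := hint
  have h0 : 0 ≤ n := by exact_mod_cast t0
  have h1 : n ≤ 1 := by exact_mod_cast t1
  obtain rfl | rfl : n = 0 ∨ n = 1 := by omega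
  · left
    exact pos_injective (eq_of_coords (by simpa using hA) (by simpa using hB))
  · right
    exact pos_injective (eq_of_coords (by simpa using hA) (by simpa using hB))

/-- Every edge of the grid belongs to a hexagon. -/
theorem exists_incident {P Q : HexVertex} (hPQ : hexGrid.Adj P Q) :
    ∃ h, Incident P h ∧ Incident Q h := by
  have sP := P.sum_eq
  have sQ := Q.sum_eq
  rw [hexGrid_adj_iff] at hPQ
  rcases hPQ with h | h | h | h | h | h
  · exact ⟨⟨P.x, P.y, P.z - 1, by omega⟩, by simp only [Incident]; omega⟩
  · exact ⟨⟨Q.x, Q.y, Q.z - 1, by omega⟩, by simp only [Incident]; omega⟩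
  · exact ⟨⟨P.x, P.y, P.z - 1, by omega⟩, by simp only [Incident]; omega⟩
  · exact ⟨⟨Q.x, Q.y, Q.z - 1, by omega⟩, by simp only [Incident]; omega⟩
  · exact ⟨⟨P.x, P.y - 1, P.z, by omega⟩, by simp only [Incident]; omega⟩
  · exact ⟨⟨Q.x, Q.y - 1, Q.z, by omega⟩, by simp only [Incident]; omega⟩

/-! ### The region bounded by a closed walk -/

section Region

variable {v : HexVertex} (Z : hexGrid.Walk v v)

theorem isCompact_curve : IsCompact (curve Z) := by
  have h : curve Z = ⋃ a ∈ {a | a ∈ Z.support}, ⋃ b ∈ {b | b ∈ Z.support ∧ s(a, b) ∈ Z.edges},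
      segment ℝ a.pos b.pos := by
    ext p
    simp only [curve, Set.mem_ofPred_eq, Set.mem_iUnion, exists_prop]
    constructor
    · rintro ⟨a, b, hab, hp⟩
      exact ⟨a, Z.fst_mem_support_of_mem_edges hab, b,
        ⟨Z.snd_mem_support_of_mem_edges hab, hab⟩, hp⟩
    · rintro ⟨a, -, b, ⟨-, hab⟩, hp⟩
      exact ⟨a, b, hab, hp⟩
  have hfin : {a | a ∈ Z.support}.Finite := List.finite_toSet _
  rw [h]
  refine hfin.isCompact_biUnion fun a _ => ?_
  refine (hfin.subset fun b hb => hb.1).isCompact_biUnion fun b _ => ?_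
  rw [show segment ℝ a.pos b.pos = convexHull ℝ {a.pos, b.pos} from (convexHull_pair _ _).symm]
  exact (Set.toFinite _).isCompact_convexHull (𝕜 := ℝ)

/-- A neighbourhood of infinity that avoids the curve. -/
theorem exists_outside : ∃ M : ℝ, ∃ O : Set ℂ, IsPreconnected O ∧ O ⊆ (curve Z)ᶜ ∧
    (∀ r : ℝ, M < r → (r : ℂ) ∈ O) ∧ Bornology.IsBounded Oᶜ := by
  obtain ⟨M, hM⟩ := (isCompact_curve Z).isBounded.exists_norm_le
  have hconv : ∀ (f : ℂ →L[ℝ] ℝ), IsPreconnected {p | M < f p} := fun f =>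
    (convex_halfSpace_gt f.toLinearMap.isLinear M).isPreconnected
  -- Four half-planes around a square containing the curve, joined at successive overlaps.
  let O₁ : Set ℂ := {p | M < Complex.reCLM p}
  let O₂ : Set ℂ := {p | M < Complex.imCLM p}
  let O₃ : Set ℂ := {p | M < (-Complex.reCLM) p}
  let O₄ : Set ℂ := {p | M < (-Complex.imCLM) p}
  have h12 : IsPreconnected (O₁ ∪ O₂) := by
    refine (hconv _).union (⟨M + 1, M + 1⟩ : ℂ) ?_ ?_ (hconv _) <;>
      exact (show M < M + 1 by linarith)
  have h123 : IsPreconnected ((O₁ ∪ O₂) ∪ O₃) :=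
    h12.union (⟨-M - 1, M + 1⟩ : ℂ) (Or.inr (show M < M + 1 by linarith))
      (show M < -(-M - 1) by linarith) (hconv _)
  have h1234 : IsPreconnected (((O₁ ∪ O₂) ∪ O₃) ∪ O₄) :=
    h123.union (⟨-M - 1, -M - 1⟩ : ℂ) (Or.inr (show M < -(-M - 1) by linarith))
      (show M < -(-M - 1) by linarith) (hconv _)
  refine ⟨M, _, h1234, ?_, ?_, ?_⟩
  · intro p hp hpc
    have h1 := hM p hpc
    have h2 := abs_le.1 ((Complex.abs_re_le_norm p).trans h1)
    have h3 := abs_le.1 ((Complex.abs_im_le_norm p).trans h1)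
    rcases hp with ((hp | hp) | hp) | hp
    · exact absurd (show M < p.re from hp) (by linarith)
    · exact absurd (show M < p.im from hp) (by linarith)
    · exact absurd (show M < -p.re from hp) (by linarith)
    · exact absurd (show M < -p.im from hp) (by linarith)
  · intro r hr
    exact Or.inl (Or.inl (Or.inl (show M < ((r : ℂ)).re from hr)))
  · refine ((Metric.isBounded_Icc (-M) M).reProdIm (Metric.isBounded_Icc (-M) M)).subset ?_
    intro p hp
    have h1 : ¬ M < p.re := fun h => hp (Or.inl (Or.inl (Or.inl h)))
    have h2 : ¬ M < p.im := fun h => hp (Or.inl (Or.inl (Or.inr h)))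
    have h3 : ¬ M < -p.re := fun h => hp (Or.inl (Or.inr h))
    have h4 : ¬ M < -p.im := fun h => hp (Or.inr h)
    exact ⟨⟨by linarith, by linarith⟩, ⟨by linarith, by linarith⟩⟩

theorem not_mem_closedRegion_iff {p : ℂ} : p ∉ closedRegion Z ↔
    p ∉ curve Z ∧ ¬ Bornology.IsBounded (connectedComponentIn (curve Z)ᶜ p) := by
  simp only [closedRegion, Set.mem_ofPred_eq]
  tauto

theorem mem_closedRegion_iff_of_mem_component {p q : ℂ}
    (hq : q ∈ connectedComponentIn (curve Z)ᶜ p) :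
    q ∈ closedRegion Z ↔ p ∈ closedRegion Z := by
  have hq' : q ∉ curve Z := connectedComponentIn_subset _ _ hq
  have hp' : p ∉ curve Z := connectedComponentIn_nonempty_iff.1 ⟨q, hq⟩
  rw [← not_iff_not, not_mem_closedRegion_iff, not_mem_closedRegion_iff,
    connectedComponentIn_eq hq]
  simp [hq', hp']

/-- A connected set that avoids the curve lies inside or outside the region. -/
theorem mem_closedRegion_iff_of_isPreconnected {S : Set ℂ} (hS : IsPreconnected S)
    (hSc : S ⊆ (curve Z)ᶜ) {p q : ℂ} (hp : p ∈ S) (hq : q ∈ S) :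
    q ∈ closedRegion Z ↔ p ∈ closedRegion Z :=
  mem_closedRegion_iff_of_mem_component Z (hS.subset_connectedComponentIn hp hSc hq)

theorem isClosed_closedRegion : IsClosed (closedRegion Z) := by
  rw [← isOpen_compl_iff, isOpen_iff_forall_mem_open]
  intro p hp
  have hp' := (not_mem_closedRegion_iff Z).1 hp
  refine ⟨connectedComponentIn (curve Z)ᶜ p, fun q hq => ?_,
    (isCompact_curve Z).isClosed.isOpen_compl.connectedComponentIn, mem_connectedComponentIn hp'.1⟩
  exact fun h => hp ((mem_closedRegion_iff_of_mem_component Z hq).1 h)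

/-- A component of the complement of the curve that misses `O` lies in the bounded set `Oᶜ`. So
there is just one unbounded component, the one containing `O`, and it is the complement of the
region. -/
theorem isPreconnected_compl_closedRegion_and_isBounded :
    IsPreconnected (closedRegion Z)ᶜ ∧ Bornology.IsBounded (closedRegion Z) := by
  obtain ⟨M, O, hO, hOc, hM, hb⟩ := exists_outside Z
  have hunb : ¬ Bornology.IsBounded O := by
    intro h
    obtain ⟨C, hC⟩ := h.exists_norm_le
    have h1 := hC _ (hM (|M| + |C| + 1) (by linarith [le_abs_self M, abs_nonneg C]))
    rw [Complex.norm_real, Real.norm_eq_abs] at h1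
    linarith [le_abs_self (|M| + |C| + 1), le_abs_self C, abs_nonneg M]
  have hOU : ∀ p ∈ O, p ∈ (closedRegion Z)ᶜ := fun p hp =>
    (not_mem_closedRegion_iff Z).2 ⟨hOc hp, fun h =>
      hunb (h.subset (hO.subset_connectedComponentIn hp hOc))⟩
  refine ⟨?_, hb.subset fun p hp hpO => hOU p hpO hp⟩
  obtain ⟨o, ho⟩ : O.Nonempty := ⟨_, hM (M + 1) (by linarith)⟩
  have hU : (closedRegion Z)ᶜ = connectedComponentIn (curve Z)ᶜ o := by
    ext p
    constructor
    · intro hp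
      have hp' := (not_mem_closedRegion_iff Z).1 hp
      have hne : (connectedComponentIn (curve Z)ᶜ p ∩ O).Nonempty := by
        by_contra h
        rw [Set.not_nonempty_iff_eq_empty] at h
        exact hp'.2 (hb.subset fun q hq hqO => by
          have : q ∈ connectedComponentIn (curve Z)ᶜ p ∩ O := ⟨hq, hqO⟩
          simp [h] at this)
      obtain ⟨q, hq, hqO⟩ := hne
      have h1 := hO.subset_connectedComponentIn hqO hOc ho
      rw [← connectedComponentIn_eq h1, ← connectedComponentIn_eq hq]
      exact mem_connectedComponentIn hp'.1
    · exact fun hp h => hOU o ho ((mem_closedRegion_iff_of_mem_component Z hp).1 h)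
  rw [hU]
  exact isPreconnected_connectedComponentIn

theorem openTile_subset_compl_curve (h : HexCell) : openTile h ⊆ (curve Z)ᶜ := by
  rintro p hp ⟨a, b, hab, hpab⟩
  exact Set.disjoint_left.1 (segment_disjoint_openTile (Z.adj_of_mem_edges hab) h) hpab hp

theorem mem_openTile_iff {h : HexCell} {p : ℂ} (hp : p ∈ openTile h) :
    p ∈ closedRegion Z ↔ h.center ∈ closedRegion Z :=
  mem_closedRegion_iff_of_isPreconnected Z (convex_openTile h).isPreconnected
    (openTile_subset_compl_curve Z h) (center_mem_openTile h) hp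

theorem tile_subset_closedRegion {h : HexCell} (hc : h.center ∈ closedRegion Z) :
    tile h ⊆ closedRegion Z :=
  (tile_subset_closure h).trans ((isClosed_closedRegion Z).closure_subset_iff.2
    fun _ hp => (mem_openTile_iff Z hp).2 hc)

theorem benzenoidSystem_adj_of_center_mem {h : HexCell} (hc : h.center ∈ closedRegion Z)
    {P Q : HexVertex} (hP : Incident P h) (hQ : Incident Q h) (hPQ : hexGrid.Adj P Q) :
    (benzenoidSystem Z).Adj P Q :=
  ⟨hPQ, ((convex_tile h).segment_subset (pos_mem_tile hP) (pos_mem_tile hQ)).trans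
    (tile_subset_closedRegion Z hc)⟩

theorem isEdgeImage_val_iff {P Q : HexVertex} :
    IsEdgeImage (benzenoidSystem Z).coe Subtype.val P Q ↔ (benzenoidSystem Z).Adj P Q := by
  constructor
  · rintro ⟨p, q, rfl, rfl, h⟩
    exact h
  · intro h
    exact ⟨⟨P, h.fst_mem⟩, ⟨Q, h.snd_mem⟩, rfl, rfl, h⟩

/-- If `h'` were not linked to `h`, the hexagons linked to `h` and the remaining ones would give two
closed sets covering the connected exterior and both meeting it. An exterior point common to both
lies on an edge shared by two hexagons; that edge leaves the region, so it is itself a link. -/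
theorem reflTransGen_isLink {h h' : HexCell} (hh : h.center ∉ closedRegion Z)
    (hh' : h'.center ∉ closedRegion Z) :
    Relation.ReflTransGen (IsLink (benzenoidSystem Z).coe Subtype.val) h h' := by
  by_contra hcon
  set L := {k | Relation.ReflTransGen (IsLink (benzenoidSystem Z).coe Subtype.val) h k} with hL
  have hclosed : ∀ S : Set HexCell, IsClosed (⋃ k : S, tile k) := fun S =>
    (locallyFinite_tile.comp_injective Subtype.val_injective).isClosed_iUnion
      fun k => isClosed_tile k
  have hcover : (closedRegion Z)ᶜ ⊆ (⋃ k : L, tile k) ∪ ⋃ k : (Lᶜ : Set HexCell), tile k := by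
    intro p _
    obtain ⟨k, hk⟩ := exists_mem_tile p
    by_cases hkL : k ∈ L
    · exact Or.inl (Set.mem_iUnion.2 ⟨⟨k, hkL⟩, hk⟩)
    · exact Or.inr (Set.mem_iUnion.2 ⟨⟨k, hkL⟩, hk⟩)
  have hcenter : ∀ k : HexCell, k.center ∈ tile k := fun k => by
    simp [tile, coordA_center, coordB_center]
  obtain ⟨p, hpU, hp1, hp2⟩ := isPreconnected_closed_iff.1
    (isPreconnected_compl_closedRegion_and_isBounded Z).1 _ _ (hclosed L) (hclosed Lᶜ) hcover
    ⟨h.center, hh, Set.mem_iUnion.2 ⟨⟨h, Relation.ReflTransGen.refl⟩, hcenter h⟩⟩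
    ⟨h'.center, hh', Set.mem_iUnion.2 ⟨⟨h', hcon⟩, hcenter h'⟩⟩
  obtain ⟨⟨k, hk⟩, hpk⟩ := Set.mem_iUnion.1 hp1
  obtain ⟨⟨k', hk'⟩, hpk'⟩ := Set.mem_iUnion.1 hp2
  have hne : k ≠ k' := fun e => hk' (e ▸ hk)
  obtain ⟨P, Q, hPQ, h1, h2, h3, h4, hseg⟩ := exists_common_edge hne hpk hpk'
  refine hk' (Relation.ReflTransGen.tail hk ⟨P, Q, hPQ, h1, h2, h3, h4, fun hE => ?_⟩)
  exact hpU (((isEdgeImage_val_iff Z).1 hE).2 hseg)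

/-! ### Finiteness, chart and connectedness of benzenoid systems -/

theorem finite_verts : (benzenoidSystem Z).verts.Finite := by
  have hb := (isPreconnected_compl_closedRegion_and_isBounded Z).2
  obtain ⟨C, hC⟩ := (coordA.lipschitz.isBounded_image hb).exists_norm_le
  obtain ⟨D, hD⟩ := (coordB.lipschitz.isBounded_image hb).exists_norm_le
  obtain ⟨N, hN⟩ := exists_nat_ge (max C D)
  have hinj : Function.Injective (fun a : HexVertex => (a.x, a.y, a.z)) := by
    intro a b hab
    simp only [Prod.mk.injEq] at hab
    exact HexVertex.ext hab.1 hab.2.1 hab.2.2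
  refine (((Set.finite_Icc (-(N : ℤ) - 1) (N + 1)).prod ((Set.finite_Icc (-(N : ℤ) - 1)
    (N + 1)).prod (Set.finite_Icc (-(N : ℤ) - 1) (N + 1)))).preimage hinj.injOn).subset ?_
  intro a ha
  have h1 := hC _ ⟨a.pos, ha, rfl⟩
  have h2 := hD _ ⟨a.pos, ha, rfl⟩
  rw [Real.norm_eq_abs, coordA_pos] at h1
  rw [Real.norm_eq_abs, coordB_pos] at h2
  have h1' := abs_le.1 (h1.trans ((le_max_left C D).trans hN))
  have h2' := abs_le.1 (h2.trans ((le_max_right C D).trans hN))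
  norm_cast at h1' h2'
  have hs := a.sum_eq
  simp only [Set.mem_preimage, Set.mem_prod, Set.mem_Icc]
  omega

/-- The chart of a benzenoid system. -/
def chart : Chart (benzenoidSystem Z).coe where
  toFun := Subtype.val
  inj := Subtype.val_injective
  adj _ _ h := h.1
  finite_full := by
    -- A hexagon is determined by its vertex `(a + 1, b, c)`, which belongs to `G` if the hexagon is
    -- full.
    have hinj : Function.Injective (fun h : HexCell =>
        (⟨h.a + 1, h.b, h.c, by have := h.sum_eq; omega⟩ : HexVertex)) := by
      intro h k hk
      simp only [HexVertex.mk.injEq, add_left_inj] at hk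
      exact HexCell.ext hk.1 hk.2.1 hk.2.2
    refine ((finite_verts Z).preimage hinj.injOn).subset fun h hh => ?_
    have hs := h.sum_eq
    have := hh ⟨h.a + 1, h.b, h.c, by omega⟩ ⟨h.a + 1, h.b + 1, h.c, by omega⟩
      (by simp [Incident]) (by simp [Incident]) (by rw [hexGrid_adj_iff]; simp)
    exact ((isEdgeImage_val_iff Z).1 this).fst_mem
  linked h h' hh hh' := by
    have key : ∀ k, ¬ IsFull (benzenoidSystem Z).coe Subtype.val k → k.center ∉ closedRegion Z :=
      fun k hk hc => hk fun P Q hP hQ hPQ =>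
        (isEdgeImage_val_iff Z).2 (benzenoidSystem_adj_of_center_mem Z hc hP hQ hPQ)
    exact reflTransGen_isLink Z (key h hh) (key h' hh')

/-- A vertex that is not on the walk has all its edges in the region. -/
theorem benzenoidSystem_adj_of_not_mem_support {a b : HexVertex} (ha : a.pos ∈ closedRegion Z)
    (haZ : a ∉ Z.support) (hab : hexGrid.Adj a b) : (benzenoidSystem Z).Adj a b := by
  obtain ⟨h, hah, hbh⟩ := exists_incident hab
  refine benzenoidSystem_adj_of_center_mem Z (h := h) ?_ hah hbh hab
  have hac : a.pos ∉ curve Z := by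
    rintro ⟨P, Q, hPQ, hseg⟩
    rcases eq_or_eq_of_pos_mem_segment (Z.adj_of_mem_edges hPQ) hseg with rfl | rfl
    · exact haZ (Z.fst_mem_support_of_mem_edges hPQ)
    · exact haZ (Z.snd_mem_support_of_mem_edges hPQ)
  have hopen : IsOpen (connectedComponentIn (curve Z)ᶜ a.pos) :=
    (isCompact_curve Z).isClosed.isOpen_compl.connectedComponentIn
  -- The component of `a` is open and `a` is a limit of interior points of the hexagon, so the
  -- hexagon lies on the same side of the curve as `a`.
  obtain ⟨q, hq, hqh⟩ := mem_closure_iff.1 (tile_subset_closure h (pos_mem_tile hah)) _ hopen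
    (mem_connectedComponentIn hac)
  exact (mem_openTile_iff Z hqh).1 ((mem_closedRegion_iff_of_mem_component Z hq).2 ha)

/-- Vertices not reachable from the walk would keep all their grid neighbours in `G`, and these
would be unreachable too. Such a set is unbounded in `x`, whereas `G` is finite. -/
theorem connected_benzenoidSystem (hZ : ¬ Z.Nil) : (benzenoidSystem Z).coe.Connected := by
  have hedge : ∀ {a b : HexVertex}, s(a, b) ∈ Z.edges → (benzenoidSystem Z).Adj a b :=
    fun {a b} hab => ⟨Z.adj_of_mem_edges hab, fun p hp => Or.inl ⟨a, b, hab, hp⟩⟩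
  have hv : v ∈ (benzenoidSystem Z).verts := by
    cases Z with
    | nil => exact absurd SimpleGraph.Walk.Nil.nil hZ
    | @cons _ b _ h w =>
      exact (hedge (show s(v, b) ∈ (SimpleGraph.Walk.cons h w).edges by simp)).fst_mem
  let R : HexVertex → Prop := fun a =>
    ∃ ha : a ∈ (benzenoidSystem Z).verts, (benzenoidSystem Z).coe.Reachable ⟨v, hv⟩ ⟨a, ha⟩
  have hR : ∀ {a b}, R a → (benzenoidSystem Z).Adj a b → R b := by
    rintro a b ⟨ha, hr⟩ hab
    exact ⟨hab.snd_mem, hr.trans (SimpleGraph.Adj.reachable (show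
      (benzenoidSystem Z).coe.Adj ⟨a, ha⟩ ⟨b, hab.snd_mem⟩ from hab))⟩
  have hwalk : ∀ {a b : HexVertex} (w : hexGrid.Walk a b), (∀ e ∈ w.edges, e ∈ Z.edges) →
      R a → R b := by
    intro a b w
    induction w with
    | nil => exact fun _ h => h
    | cons h w ih =>
      intro hw ha
      rw [SimpleGraph.Walk.edges_cons] at hw
      exact ih (fun e he => hw e (List.mem_cons_of_mem _ he))
        (hR ha (hedge (hw _ List.mem_cons_self)))
  have hRv : R v := ⟨hv, SimpleGraph.Reachable.refl _⟩
  have hsupp : ∀ a ∈ Z.support, R a := by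
    classical
    intro a ha
    exact hwalk (Z.takeUntil a ha) (fun e he => Z.edges_takeUntil_subset_edges ha he) hRv
  have hall : ∀ a ∈ (benzenoidSystem Z).verts, R a := by
    by_contra! hcon
    let S : Set HexVertex := {a | a ∈ (benzenoidSystem Z).verts ∧ ¬ R a}
    have hS : ∀ {a b}, a ∈ S → hexGrid.Adj a b → b ∈ S := by
      rintro a b ⟨ha, hna⟩ hab
      have hadj := benzenoidSystem_adj_of_not_mem_support Z ha (fun h => hna (hsupp a h)) hab
      exact ⟨hadj.snd_mem, fun hb => hna (hR hb hadj.symm)⟩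
    obtain ⟨a, ha, hmax⟩ := Set.exists_max_image S HexVertex.x
      ((finite_verts Z).subset fun a h => h.1) hcon
    have hup : ∀ a ∈ S, a.x + a.y + a.z = 0 → ∃ b ∈ S, b.x = a.x + 1 := fun a ha h =>
      ⟨⟨a.x + 1, a.y, a.z, by omega⟩, hS ha (by rw [hexGrid_adj_iff]; simp), rfl⟩
    rcases a.sum_eq with h | h
    · obtain ⟨b, hb, hbx⟩ := hup a ha h
      have := hmax b hb
      omega
    -- With coordinate sum 1, `x` cannot be raised directly; lowering `y` first restores sum 0.
    · have hb : (⟨a.x, a.y - 1, a.z, by omega⟩ : HexVertex) ∈ S :=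
        hS ha (by rw [hexGrid_adj_iff]; simp)
      obtain ⟨b, hb, hbx⟩ := hup _ hb (by dsimp only; omega)
      have := hmax b hb
      dsimp only at hbx
      omega
  have : Nonempty (benzenoidSystem Z).verts := ⟨⟨v, hv⟩⟩
  refine SimpleGraph.Connected.mk fun a b => ?_
  obtain ⟨_, ha⟩ := hall a.1 a.2
  obtain ⟨_, hb⟩ := hall b.1 b.2
  exact ha.symm.trans hb

end Region

end Benzenoid

/-- Every benzenoid system has `G²`-connected medians. -/
theorem mainTheorem12 {v : Benzenoid.HexVertex} (Z : Benzenoid.hexGrid.Walk v v)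
    (hZ : Z.IsCycle) :
    Benzenoid.HasPowerConnectedMedians (Benzenoid.benzenoidSystem Z).coe 2 := by
  have : Finite (Benzenoid.benzenoidSystem Z).verts := (Benzenoid.finite_verts Z).to_subtype
  exact (Benzenoid.chart Z).hasPowerConnectedMedians
    (Benzenoid.connected_benzenoidSystem Z hZ.not_nil)
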